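/- **Definitions.** Words are over an alphabet $\{0,\dots,\sigma-1\}$; $T$ is a text of length $n$, positions are numbered $0,\dots,n-1$, and $T[s..e]$ is the substring from position $s$ to position $e$ inclusive. * A pattern $P$ is *periodic* if it can appear more than twice overlapping: some text contains three distinct occurrences of $P$ any two of which overlap. * A non-empty word $p$ is a *period* of $x$ if $x=p^tp'$ with $t\ge 1$ and $p'$ a prefix of $p$. * $[s,e]$ is a *period sequence* of $T$ with period $p$ if $p$ is the shortest period of $T[s..e]$, $e-s+1>2|p|$, and no larger substring $T[s'..e']$ with $s'\le s$, $e\le e'$ has the period $p$. The period sequences *of a periodic pattern* $P$ are those whose period is the shortest period of $P$ and for which $T[s..e]$ starts with $P$. * $occ_{NO}(P)$ is the maximal number of pairwise non-overlapping occurrences of $P$ in $T$. * The suffix tree of $T$ is the compacted trie of all suffixes of $T\$$, where $\$$ is an end marker. A *place* of the tree is a node or a position inside an edge. The *period path* of $p$ is the set of all places that represent a periodic pattern with shortest period $p$. **Data structure.** Store $T$ and its suffix tree (for each node a record with its depth, a position of its string in $T\$$ and a pointer to its parent). For each period path, store the list of all period sequences with the period of the path, sorted by length. For each node $v$ and each period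 path that contains a place $x$ which is $v$ or lies inside the edge entering $v$, store in the record of $v$ a pointer to the first sequence in the list of that path whose length is at least $|x|$ (this does not depend on the choice of $x$). Further words, such as a dictionary for finding children, may be stored; all words count as space. **Model.** A word RAM whose words are the numbers below $(n+\sigma)^k$ for a constant $k$, with unit-cost addition, subtraction, multiplication, division with remainder, comparison, reading of the stored array, reading of a letter of the pattern, and output. **Theorem.** There are constants $C$ and $k$ and a single query program, independent of $\sigma$, $T$ and $P$, such that for every alphabet size $\sigma$ and every text $T$ of length $n\ge 2$ the data structure described above can be stored in at most $C\,n\lfloor\log_2 n\rfloor$ words, that is, in $O(n\log n)$ space, and such that for every periodic pattern $P$ of length $m$ the query program, run on the stored words and $P$, stops after at most $C\,(m+occ_{NO}(P))$ steps and outputs all period sequences $[s,e]$ of $P$, each exactly once; they form a final segment of the list of the period path of $P$. -/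

import Mathlib

namespace PeriodIndexing

/-! ### Words, occurrences, periods -/

section Words

variable {α : Type*}

/-- `P` occurs in `T` with its first letter at position `i` (positions are numbered from `0`). -/
def OccursAt (P T : List α) (i : ℕ) : Prop := P <+: T.drop i

/-- The substring of `T` from position `s` to position `e`, both included. -/
def substr (T : List α) (s e : ℕ) : List α := (T.drop s).take (e + 1 - s)

open Classical in
/-- The maximal number of pairwise non-overlapping occurrences of `P` in `T`. -/
noncomputable def occNO (T P : List α) : ℕ :=
  ((Finset.range T.length).powerset.filter fun S =>
    (∀ i ∈ S, OccursAt P T i) ∧ ∀ i ∈ S, ∀ j ∈ S, i < j → i + P.length ≤ j).sup Finset.card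

/-- A periodic pattern: one that can appear more than twice overlapping, i.e. some text contains
three distinct occurrences of it any two of which overlap. -/
def IsPeriodicPattern (P : List α) : Prop :=
  ∃ (U : List α) (i j k : ℕ), i < j ∧ j < k ∧ k < i + P.length ∧
    OccursAt P U i ∧ OccursAt P U j ∧ OccursAt P U k

/-- `p` is a period of `x`: `x = p ^ t p'` with `t ≥ 1` and `p'` a prefix of `p`. -/
def IsPeriod (p x : List α) : Prop :=
  p ≠ [] ∧ ∃ (t : ℕ) (p' : List α), 1 ≤ t ∧ p' <+: p ∧ x = (List.replicate t p).flatten ++ p'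

/-- `p` is the shortest period of `x`. -/
def IsShortestPeriod (p x : List α) : Prop :=
  IsPeriod p x ∧ ∀ q, IsPeriod q x → p.length ≤ q.length

/-- `[s, e]` is a period sequence of the text `T` with period `p`: the substring `T[s..e]` is a
repetition of its shortest period `p`, it is longer than two copies of `p`, and no larger
substring around it has the period `p`. -/
def IsPeriodSequence (T p : List α) (s e : ℕ) : Prop :=
  s ≤ e ∧ e < T.length ∧ IsShortestPeriod p (substr T s e) ∧ 2 * p.length < e + 1 - s ∧
    ∀ s' e', s' ≤ s → e ≤ e' → e' < T.length → IsPeriod p (substr T s' e') → s' = s ∧ e' = e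

/-- The length of the period sequence `[s, e]`. -/
def seqLength (x : ℕ × ℕ) : ℕ := x.2 + 1 - x.1

/-- The period sequences of the pattern `P` in `T`: those which repeat the period of `P` and
start with `P`. -/
def periodSequencesOf (T P : List α) : Set (ℕ × ℕ) :=
  {x | ∃ p, IsShortestPeriod p P ∧ IsPeriodSequence T p x.1 x.2 ∧ P <+: substr T x.1 x.2}

/-! ### The suffix tree -/

/-- The text followed by an end marker `none`, which is not a letter. -/
def marked (T : List α) : List (Option α) := T.map some ++ [none]

/-- The nodes of the suffix tree of `T` (the compacted trie of all suffixes of the marked text),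
each given by the string that it represents: the root, the leaves (these are the suffixes) and the
branching nodes. -/
def IsNode (T : List α) (v : List (Option α)) : Prop :=
  v <:+ marked T ∨ ∃ a b, a ≠ b ∧ v ++ [a] <:+: marked T ∧ v ++ [b] <:+: marked T

/-- `u` is the parent of the node `v`. -/
def IsParent (T : List α) (u v : List (Option α)) : Prop :=
  IsNode T u ∧ IsNode T v ∧ u <+: v ∧ u ≠ v ∧
    ∀ w, IsNode T w → w <+: v → w ≠ v → w <+: u

/-- `v` is the node at which the search for `x` in the suffix tree ends: the highest node whose
string starts with `x`. So `x` is `v`, or a place inside the edge that enters `v`. -/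
def IsLocus (T : List α) (x : List α) (v : List (Option α)) : Prop :=
  IsNode T v ∧ x.map some <+: v ∧ ∀ u, IsNode T u → x.map some <+: u → v <+: u

/-- The period path of the period `p` in the suffix tree: all places of the tree (at a node or
inside an edge) that represent a periodic pattern whose shortest period is `p`. -/
def periodPath (T p : List α) : Set (List α) :=
  {x | x <:+: T ∧ IsPeriodicPattern x ∧ IsShortestPeriod p x}

end Words

/-! ### The data structure, as stored in an array of machine words -/

/-- The array `M` stores the suffix tree of `T`, the list of period sequences of each period path
sorted by length, and the pointers from the nodes into these lists. `M` may hold further words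
(for instance a dictionary for finding children). -/
structure PeriodIndex {σ : ℕ} (T : List (Fin σ)) (M : List ℕ) where
  /-- the address of the text -/
  text : ℕ
  text_eq : ∀ (i : ℕ) (a : Fin σ), T[i]? = some a → M[text + i]? = some (a : ℕ)
  /-- the record of the node `v` occupies the addresses `node v, …, node v + width v - 1` -/
  node : List (Option (Fin σ)) → ℕ
  width : List (Option (Fin σ)) → ℕ
  width_ge : ∀ v, IsNode T v → 3 ≤ width v
  records_disjoint : ∀ u v, IsNode T u → IsNode T v → u ≠ v →
    node u + width u ≤ node v ∨ node v + width v ≤ node u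
  /-- word `0` of a record: the length of the string of the node -/
  depth_eq : ∀ v, IsNode T v → M[node v]? = some v.length
  /-- word `1` of a record: a place in the marked text where the string of the node occurs -/
  label_eq : ∀ v, IsNode T v → ∃ i, M[node v + 1]? = some i ∧ OccursAt v (marked T) i
  /-- word `2` of a record: the address of the parent -/
  parent_eq : ∀ u v, IsParent T u v → M[node v + 2]? = some (node u)
  /-- the list of all period sequences of the period path of `p`, sorted by length -/
  seqs : List (Fin σ) → List (ℕ × ℕ)
  mem_seqs : ∀ p x, x ∈ seqs p ↔ IsPeriodSequence T p x.1 x.2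
  seqs_nodup : ∀ p, (seqs p).Nodup
  seqs_sorted : ∀ p, (seqs p).Pairwise fun x y => seqLength x ≤ seqLength y
  /-- the address of the list of the period path of `p`; two words `s`, `e` per sequence -/
  list : List (Fin σ) → ℕ
  list_eq : ∀ (p : List (Fin σ)) (i : ℕ) (x : ℕ × ℕ), (seqs p)[i]? = some x →
    M[list p + 2 * i]? = some x.1 ∧ M[list p + 2 * i + 1]? = some x.2
  /-- the address, in the record of `v`, of the pointer from `v` to the list of the period path of
  `p`, which exists if that path meets `v` or the edge that enters `v` -/
  slot : List (Option (Fin σ)) → List (Fin σ) → ℕ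
  slot_mem : ∀ v p x, x ∈ periodPath T p → IsLocus T x v →
    node v + 3 ≤ slot v p ∧ slot v p < node v + width v
  /-- the pointer leads to the first sequence of the list that is at least as long as `x` -/
  slot_eq : ∀ v p x, x ∈ periodPath T p → IsLocus T x v →
    M[slot v p]? = some (list p + 2 * (seqs p).countP fun y => seqLength y < x.length)

/-! ### The machine: a word RAM with a step count -/

/-- Arithmetic instructions. -/
inductive Op
  | add
  | sub
  | mul
  | div
  | mod

/-- The value of an arithmetic instruction (before it is reduced to a word). -/
def Op.eval : Op → ℕ → ℕ → ℕ
  | .add, x, y => x + y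
  | .sub, x, y => x - y
  | .mul, x, y => x * y
  | .div, x, y => x / y
  | .mod, x, y => x % y

/-- Programs. Numbers `d a b` are names of registers. -/
inductive Cmd
  /-- write the constant `k` to register `d` -/
  | const (d k : ℕ)
  /-- apply an arithmetic operation to the registers `a`, `b` and write the result to `d` -/
  | arith (o : Op) (d a b : ℕ)
  /-- read the word of the stored array whose address is in register `a` -/
  | load (d a : ℕ)
  /-- read the letter of the pattern whose position is in register `a`: letter `l` is read
  as `l + 1`, and beyond the end of the pattern `0` is read -/
  | letter (d a : ℕ)
  /-- output the content of register `a` -/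
  | output (a : ℕ)
  /-- sequential composition -/
  | seq (c₁ c₂ : Cmd)
  /-- `if a < b then c₁ else c₂` -/
  | cond (a b : ℕ) (c₁ c₂ : Cmd)
  /-- `while a < b do c` -/
  | loop (a b : ℕ) (c : Cmd)

/-- The registers and the output produced so far. -/
structure State where
  reg : ℕ → ℕ
  out : List ℕ

/-- Initially all registers are `0` and nothing has been output. -/
def State.init : State := ⟨fun _ => 0, []⟩

/-- Write `x` to register `d`; a register holds a word, that is, a number below `W`. -/
def State.write (W : ℕ) (st : State) (d x : ℕ) : State :=
  ⟨Function.update st.reg d (x % W), st.out⟩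

/-- What the instruction `letter` reads at position `i` of the pattern. -/
def letterCode {σ : ℕ} (P : List (Fin σ)) (i : ℕ) : ℕ :=
  (P[i]?).elim 0 fun a => (a : ℕ) + 1

/-- `Exec W M P c st t st'`: with words below `W`, stored array `M` and pattern `P`, the program
`c` started in the state `st` stops after `t` steps in the state `st'`. Each instruction and each
test of a condition is one step. -/
inductive Exec {σ : ℕ} (W : ℕ) (M : List ℕ) (P : List (Fin σ)) : Cmd → State → ℕ → State → Prop
  | const (d k : ℕ) (st : State) : Exec W M P (.const d k) st 1 (st.write W d k)
  | arith (o : Op) (d a b : ℕ) (st : State) :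
      Exec W M P (.arith o d a b) st 1 (st.write W d (o.eval (st.reg a) (st.reg b)))
  | load (d a : ℕ) (st : State) :
      Exec W M P (.load d a) st 1 (st.write W d (M.getD (st.reg a) 0))
  | letter (d a : ℕ) (st : State) :
      Exec W M P (.letter d a) st 1 (st.write W d (letterCode P (st.reg a)))
  | output (a : ℕ) (st : State) :
      Exec W M P (.output a) st 1 ⟨st.reg, st.out ++ [st.reg a]⟩
  | seq {c₁ c₂ : Cmd} {st st' st'' : State} {t₁ t₂ : ℕ}
      (h₁ : Exec W M P c₁ st t₁ st') (h₂ : Exec W M P c₂ st' t₂ st'') :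
      Exec W M P (.seq c₁ c₂) st (t₁ + t₂) st''
  | cond_true {a b : ℕ} {c₁ c₂ : Cmd} {st st' : State} {t : ℕ} (h : st.reg a < st.reg b)
      (h₁ : Exec W M P c₁ st t st') : Exec W M P (.cond a b c₁ c₂) st (t + 1) st'
  | cond_false {a b : ℕ} {c₁ c₂ : Cmd} {st st' : State} {t : ℕ} (h : ¬ st.reg a < st.reg b)
      (h₂ : Exec W M P c₂ st t st') : Exec W M P (.cond a b c₁ c₂) st (t + 1) st'
  | loop_stop {a b : ℕ} {c : Cmd} {st : State} (h : ¬ st.reg a < st.reg b) :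
      Exec W M P (.loop a b c) st 1 st
  | loop_step {a b : ℕ} {c : Cmd} {st st' st'' : State} {t₁ t₂ : ℕ} (h : st.reg a < st.reg b)
      (h₁ : Exec W M P c st t₁ st') (h₂ : Exec W M P (.loop a b c) st' t₂ st'') :
      Exec W M P (.loop a b c) st (t₁ + t₂ + 1) st''

/-- The program `c` stops after `t` steps, and what it has output is the list `L` of pairs. -/
def Outputs {σ : ℕ} (W : ℕ) (M : List ℕ) (P : List (Fin σ)) (c : Cmd) (t : ℕ)
    (L : List (ℕ × ℕ)) : Prop :=
  ∃ st : State, Exec W M P c State.init t st ∧ st.out = L.flatMap fun x => [x.1, x.2]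

end PeriodIndexing

/-!
The proof constructs the array and the query program explicitly.

*Space.* A period path meets the edge above a node `v` only if its period `p` is the smallest period
of a prefix of `v` that is longer than `2 |p|`. Among three such periods of one word the largest is
more than twice the smallest (`periodLengths_gap`; this is where the theorem of Fine and Wilf
enters), and so there are `O(log n)` of them (`card_le_of_subset_periodLengths`). Since the suffix
tree has `O(n)` nodes (`exists_finset_isNode`), there are `O(n log n)` pointers. The same bound,
applied to the suffixes of the text, shows that `O(log n)` period sequences start at each position,
and so the lists have total length `O(n log n)`. That a pointer does not depend on the chosen place
of the edge is `seqLength_lt_iff_of_isLocus`: a period sequence whose length lies between two places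
of a period path ends at a branching node between them.

*Query.* Children are found in constant time by a perfect hash table with two levels
(`exists_perfectHash`). The descent looks only at the letters behind the nodes; the node reached is
the locus of the pattern provided that the pattern occurs, which a single comparison with the text
decides (`matches_iff`). Along an edge the shortest period grows with the length, so in the record
of the locus the slots, sorted by the length at which their path ends, are searched for the first
one that ends at or below the pattern (`isPathEnd_of_first`); the slots before it end at different
lengths below `|P|`. From its pointer on, the list contains precisely the period sequences of the
pattern. Two of them share fewer than `|p|` positions, because otherwise their union would have the
period `p`; since `2 |p| < |P|`, their number is at most three times the number of non-overlapping
occurrences (`length_le_three_mul_occNO`), which bounds the time of the output.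

The program is verified with a small calculus of triples (`Run`), in which each rule counts steps.
-/

namespace PeriodIndexing

/-! ### Periods of words -/

section Periods

variable {α : Type*}

/-- The prefix of length `N` of the word `v` has the period `d`, in terms of letters. -/
def PerOn (v : List α) (d N : ℕ) : Prop := ∀ i, i + d < N → v[i]? = v[i + d]?

theorem PerOn.mono {v : List α} {d N N' : ℕ} (h : PerOn v d N) (hN : N' ≤ N) : PerOn v d N' :=
  fun i hi => h i (by omega)

theorem perOn_iff_hasPeriod {v : List α} {d N : ℕ} (hN : N ≤ v.length) :
    PerOn v d N ↔ (v.take N).HasPeriod d := by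
  rw [List.hasPeriod_iff_getElem?]
  simp only [List.length_take, min_eq_left hN]
  refine ⟨fun h i hi => ?_, fun h i hi => ?_⟩
  · rw [List.getElem?_take_of_lt (by omega), List.getElem?_take_of_lt (by omega)]
    exact h i (by omega)
  · have := h i (by omega)
    rwa [List.getElem?_take_of_lt (by omega), List.getElem?_take_of_lt (by omega)] at this

theorem getElem?_eq_of_prefix {x v : List α} (h : x <+: v) {i : ℕ} (hi : i < x.length) :
    v[i]? = x[i]? := by
  obtain ⟨t, rfl⟩ := h
  exact List.getElem?_append_left hi

theorem perOn_of_prefix {x v : List α} (h : x <+: v) {d N : ℕ} (hN : N ≤ x.length) :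
    PerOn v d N ↔ PerOn x d N := by
  unfold PerOn
  refine forall₂_congr fun i hi => ?_
  rw [getElem?_eq_of_prefix h (by omega), getElem?_eq_of_prefix h (by omega)]

theorem prefix_of_getElem? {x v : List α} (h : ∀ i, i < x.length → v[i]? = x[i]?) : x <+: v := by
  rw [List.prefix_iff_getElem?]
  intro i hi
  rw [h i hi, List.getElem?_eq_getElem hi]

theorem prefix_of_prefix_append {p x : List α} (hp : p ≠ []) (hle : p.length ≤ x.length)
    (h : x <+: p ++ x) : ∃ (t : ℕ) (p' : List α), 1 ≤ t ∧ p' <+: p ∧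
      x = (List.replicate t p).flatten ++ p' := by
  induction hn : x.length using Nat.strong_induction_on generalizing x with
  | _ n ih =>
    have hpx : p <+: x := List.prefix_of_prefix_length_le (List.prefix_append p x) h hle
    obtain ⟨y, rfl⟩ := hpx
    have hy : y <+: p ++ y := (List.prefix_append_right_inj p).1 h
    by_cases hl : p.length ≤ y.length
    · have hp' := List.length_pos_iff.2 hp
      obtain ⟨t, p', _, h1, h2⟩ := ih y.length (by simp at hn; omega) hl hy rfl
      refine ⟨t + 1, p', by omega, h1, ?_⟩
      rw [List.replicate_succ, List.flatten_cons, List.append_assoc, ← h2]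
    · refine ⟨1, y, le_rfl, ?_, by simp⟩
      exact List.prefix_of_prefix_length_le hy (List.prefix_append p y) (by omega)

/-- A period of a word in the sense of the definition is a prefix whose length is a period in terms
of letters. -/
theorem isPeriod_iff {p x : List α} :
    IsPeriod p x ↔ p ≠ [] ∧ p <+: x ∧ PerOn x p.length x.length := by
  constructor
  · rintro ⟨hp, t, p', ht, hp', hx⟩
    have hpx : p <+: x := by
      obtain ⟨t, rfl⟩ : ∃ s, t = s + 1 := ⟨t - 1, by omega⟩
      rw [hx, List.replicate_succ, List.flatten_cons, List.append_assoc]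
      exact List.prefix_append _ _
    have hb : x <+: p ++ x := by
      have h1 : p ++ x = (List.replicate t p).flatten ++ (p ++ p') := by
        rw [hx, ← List.append_assoc, ← List.append_assoc, ← List.flatten_cons,
          ← List.replicate_succ, List.replicate_succ', List.flatten_append]
        simp
      rw [h1, hx, List.prefix_append_right_inj]
      exact hp'.trans (List.prefix_append _ _)
    refine ⟨hp, hpx, fun i hi => ?_⟩
    have := getElem?_eq_of_prefix hb hi
    rw [List.getElem?_append_right (by omega)] at this
    simpa using this
  · rintro ⟨hp, hpx, h⟩
    refine ⟨hp, prefix_of_prefix_append hp hpx.length_le ?_⟩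
    refine prefix_of_getElem? fun i hi => ?_
    by_cases hip : i < p.length
    · rw [List.getElem?_append_left hip, getElem?_eq_of_prefix hpx hip]
    · rw [List.getElem?_append_right (by omega), h (i - p.length) (by omega)]
      congr 1; omega

theorem IsPeriod.length_pos {p x : List α} (h : IsPeriod p x) : 0 < p.length :=
  List.length_pos_iff.2 h.1

theorem IsPeriod.isPrefix {p x : List α} (h : IsPeriod p x) : p <+: x := (isPeriod_iff.1 h).2.1

theorem IsPeriod.perOn {p x : List α} (h : IsPeriod p x) : PerOn x p.length x.length :=
  (isPeriod_iff.1 h).2.2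

theorem isPeriod_take {x : List α} {d : ℕ} (hd : 0 < d) (hdx : d ≤ x.length)
    (h : PerOn x d x.length) : IsPeriod (x.take d) x := by
  rw [isPeriod_iff]
  refine ⟨?_, List.take_prefix _ _, ?_⟩
  · rw [ne_eq, List.take_eq_nil_iff]
    rintro (h | h)
    · omega
    · simp [h] at hdx; omega
  · rwa [List.length_take, min_eq_left hdx]

theorem IsShortestPeriod.le_of_perOn {p x : List α} (h : IsShortestPeriod p x) {d : ℕ}
    (hd : 0 < d) (hdx : d ≤ x.length) (hper : PerOn x d x.length) : p.length ≤ d := by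
  simpa [hdx] using h.2 _ (isPeriod_take hd hdx hper)

theorem IsShortestPeriod.eq {p q x : List α} (hp : IsShortestPeriod p x)
    (hq : IsShortestPeriod q x) : p = q := by
  have h := le_antisymm (hp.2 q hq.1) (hq.2 p hp.1)
  exact (List.prefix_of_prefix_length_le hp.1.isPrefix hq.1.isPrefix h.le).eq_of_length h

/-- Two words with the same period are prefixes of one another. -/
theorem IsPeriod.prefix_of_length_le {p x y : List α} (hx : IsPeriod p x) (hy : IsPeriod p y)
    (hle : x.length ≤ y.length) : x <+: y := by
  have hpos := hx.length_pos
  refine prefix_of_getElem? fun i hi => ?_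
  induction i using Nat.strong_induction_on with
  | _ i ih =>
    by_cases hip : i < p.length
    · rw [getElem?_eq_of_prefix hx.isPrefix hip, getElem?_eq_of_prefix hy.isPrefix hip]
    · have h1 := hx.perOn (i - p.length) (by omega)
      have h2 := hy.perOn (i - p.length) (by omega)
      rw [show i - p.length + p.length = i by omega] at h1 h2
      rw [← h1, ← h2]
      exact ih _ (by omega) (by omega)

/-- A prefix of a word with period `p` has the period `p` if it is long enough. -/
theorem IsPeriod.of_prefix {p x y : List α} (hy : IsPeriod p y) (hxy : x <+: y)
    (hle : p.length ≤ x.length) : IsPeriod p x := by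
  rw [isPeriod_iff] at hy ⊢
  refine ⟨hy.1, List.prefix_of_prefix_length_le hy.2.1 hxy hle, ?_⟩
  rw [← perOn_of_prefix hxy le_rfl]
  exact hy.2.2.mono hxy.length_le

theorem IsPeriod.exists_isShortestPeriod {q x : List α} (hq : IsPeriod q x) :
    ∃ p, IsShortestPeriod p x := by
  classical
  have hex : ∃ d, ∃ p, IsPeriod p x ∧ p.length = d := ⟨_, q, hq, rfl⟩
  obtain ⟨p, hp, hd⟩ := Nat.find_spec hex
  exact ⟨p, hp, fun r hr => hd ▸ Nat.find_min' hex ⟨r, hr, rfl⟩⟩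

/-- The shift between the closest two of three pairwise overlapping occurrences is a period of the
pattern that is shorter than half of it. -/
theorem IsPeriodicPattern.exists_isShortestPeriod {P : List α} (h : IsPeriodicPattern P) :
    ∃ p, IsShortestPeriod p P ∧ 2 * p.length < P.length := by
  obtain ⟨U, i, j, k, hij, hjk, hki, hi, hj, hk⟩ := h
  have key : ∀ a b, a < b → b < a + P.length → OccursAt P U a → OccursAt P U b →
      PerOn P (b - a) P.length := by
    intro a b hab hb ha hbo t ht
    have h1 := getElem?_eq_of_prefix ha ht
    have h2 := getElem?_eq_of_prefix hbo (i := t) (by omega)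
    rw [List.getElem?_drop] at h1 h2
    rw [← h1, ← h2]
    congr 1; omega
  obtain ⟨d, hd0, hd, hper⟩ : ∃ d, 0 < d ∧ 2 * d < P.length ∧ PerOn P d P.length := by
    by_cases hc : j - i ≤ k - j
    · exact ⟨j - i, by omega, by omega, key i j hij (by omega) hi hj⟩
    · exact ⟨k - j, by omega, by omega, key j k hjk (by omega) hj hk⟩
  obtain ⟨p, hp⟩ := (isPeriod_take hd0 (by omega) hper).exists_isShortestPeriod
  exact ⟨p, hp, by have := hp.le_of_perOn hd0 (by omega) hper; omega⟩

/-! ### Counting periodic prefixes of a word -/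

/-- A period `g` of a prefix extends to a longer prefix with period `d` as soon as the short prefix
contains `d + g` letters. -/
theorem PerOn.extend {v : List α} {d g M N : ℕ} (hd : PerOn v d N) (hg : PerOn v g M)
    (hd0 : 0 < d) (hM : d + g ≤ M) : PerOn v g N := by
  intro i
  induction i using Nat.strong_induction_on with
  | _ i ih =>
    intro hi
    by_cases hc : i + g < M
    · exact hg i hc
    · have h1 := hd (i - d) (by omega)
      have h2 := hd (i + g - d) (by omega)
      rw [show i - d + d = i by omega] at h1
      rw [show i + g - d + d = i + g by omega] at h2
      rw [← h1, ← h2, ih (i - d) (by omega) (by omega)]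
      congr 1; omega

/-- The numbers `d` such that some prefix of `v` is longer than `2 * d` and has `d` as its smallest
period. -/
def periodLengths (v : List α) : Set ℕ :=
  {d | 0 < d ∧ ∃ N ≤ v.length, 2 * d < N ∧ PerOn v d N ∧ ∀ g, 0 < g → PerOn v g N → d ≤ g}

/-- Among three such periods, the largest is more than twice the smallest. Otherwise the two
differences are periods of the prefix of length `p` whose sum is at most `p`, and so their greatest
common divisor, which is smaller than `p`, is a period of all of the prefix whose smallest period
is `p`. -/
theorem periodLengths_gap {v : List α} {p q r : ℕ} (hp : p ∈ periodLengths v)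
    (hq : q ∈ periodLengths v) (hr : r ∈ periodLengths v) (hpq : p < q) (hqr : q < r) :
    2 * p < r := by
  obtain ⟨hp0, N, hN, hpN, hpp, hmin⟩ := hp
  obtain ⟨hq0, Nq, hNq, hqN, hqq, -⟩ := hq
  obtain ⟨hr0, Nr, hNr, hrN, hrr, -⟩ := hr
  by_contra hcon
  have diff : ∀ a b Na Nb, 2 * a < Na → 2 * b < Nb → a < b → PerOn v a Na → PerOn v b Nb →
      PerOn v (b - a) a := by
    intro a b Na Nb hNa hNb hab ha hb i hi
    rw [hb i (by omega), ha (i + (b - a)) (by omega)]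
    congr 1; omega
  have h1 := diff p q _ _ hpN hqN hpq hpp hqq
  have h3 := diff q r _ _ hqN hrN hqr hqq hrr
  have hg : PerOn v ((q - p).gcd (r - q)) p := by
    rw [perOn_iff_hasPeriod (by omega)]
    refine List.HasPeriod.gcd ((perOn_iff_hasPeriod (by omega)).1 h1)
      ((perOn_iff_hasPeriod (by omega)).1 (h3.mono hpq.le)) ?_
    rw [List.length_take, min_eq_left (by omega)]
    omega
  have hg0 : 0 < (q - p).gcd (r - q) := Nat.gcd_pos_of_pos_left _ (by omega)
  have hg1 : (q - p).gcd (r - q) ≤ q - p := Nat.gcd_le_left _ (by omega)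
  generalize (q - p).gcd (r - q) = g at *
  have h4 : PerOn v g q := h3.extend hg (by omega) (by omega)
  have h5 : PerOn v g N := hpp.extend h4 hp0 (by omega)
  have := hmin g hg0 h5
  omega

/-- There are only logarithmically many such periods: at most two between consecutive powers of
two. -/
theorem card_le_of_subset_periodLengths {v : List α} {S : Finset ℕ} {n : ℕ}
    (hS : ∀ d ∈ S, d ∈ periodLengths v) (hn : v.length ≤ n) :
    S.card ≤ 2 * (Nat.log 2 n + 1) := by
  have hsub : S ⊆ (Finset.range (Nat.log 2 n + 1)).biUnion
      fun j => S.filter fun d => Nat.log 2 d = j := by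
    intro d hd
    simp only [Finset.mem_biUnion, Finset.mem_range, Finset.mem_filter]
    refine ⟨_, ?_, hd, rfl⟩
    obtain ⟨_, N, h1, h2, _⟩ := hS d hd
    exact Nat.lt_succ_of_le (Nat.log_mono_right (by omega))
  refine (Finset.card_le_card hsub).trans (Finset.card_biUnion_le.trans ?_)
  refine (Finset.sum_le_card_nsmul _ _ 2 fun j _ => ?_).trans (by simp [mul_comm])
  by_contra hcon
  have key : ∀ x ∈ S.filter (fun d => Nat.log 2 d = j), ∀ y ∈ S.filter (fun d => Nat.log 2 d = j),
      ∀ z ∈ S.filter (fun d => Nat.log 2 d = j), x < y → y < z → False := by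
    intro x hx y hy z hz hxy hyz
    rw [Finset.mem_filter] at hx hy hz
    have h1 := periodLengths_gap (hS x hx.1) (hS y hy.1) (hS z hz.1) hxy hyz
    have h2 : 2 ^ j ≤ x := hx.2 ▸ Nat.pow_log_le_self 2 (hS x hx.1).1.ne'
    have h3 : z < 2 ^ (j + 1) := hz.2 ▸ Nat.lt_pow_succ_log_self (by norm_num) z
    rw [pow_succ] at h3
    omega
  obtain ⟨a, b, c, ha, hb, hc, hab, hac, hbc⟩ := Finset.two_lt_card_iff.1 (not_le.1 hcon)
  rcases lt_or_gt_of_ne hab with h1 | h1 <;> rcases lt_or_gt_of_ne hac with h2 | h2 <;>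
    rcases lt_or_gt_of_ne hbc with h3 | h3
  · exact key a ha b hb c hc h1 h3
  · exact key a ha c hc b hb h2 h3
  · omega
  · exact key c hc a ha b hb h2 h1
  · exact key b hb a ha c hc h1 h2
  · omega
  · exact key b hb c hc a ha h3 h2
  · exact key c hc b hb a ha h3 h1

theorem IsShortestPeriod.mem_periodLengths {p x v : List α} (h : IsShortestPeriod p x)
    (hlen : 2 * p.length < x.length) (hxv : x <+: v) : p.length ∈ periodLengths v := by
  refine ⟨h.1.length_pos, x.length, hxv.length_le, hlen, ?_, fun g hg hper => ?_⟩
  · exact (perOn_of_prefix hxv le_rfl).2 h.1.perOn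
  · by_cases hgx : g ≤ x.length
    · exact h.le_of_perOn hg hgx ((perOn_of_prefix hxv le_rfl).1 hper)
    · omega

end Periods

/-! ### The shape of the suffix tree -/

section SuffixTree

variable {α β : Type*}

/-- `w` is a branching node of the trie of the words in `S`. -/
def IsBranching (S : Set (List β)) (w : List β) : Prop :=
  ∃ a b, a ≠ b ∧ (∃ y ∈ S, w ++ [a] <+: y) ∧ ∃ z ∈ S, w ++ [b] <+: z

theorem prefix_of_append_singleton {w y : List β} {a : β} (h : w ++ [a] <+: y) : w <+: y :=
  (List.prefix_append w [a]).trans h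

theorem eq_of_append_singleton_prefix {w y : List β} {a b : β} (ha : w ++ [a] <+: y)
    (hb : w ++ [b] <+: y) : a = b := by
  have := (List.prefix_of_prefix_length_le ha hb (by simp)).eq_of_length (by simp)
  simpa using this

/-- A trie has no more branching nodes than words: adding the word `y` makes at most one node
branching, namely the one at which `y` leaves the trie. -/
theorem exists_finset_isBranching (S : Finset (List β)) :
    ∃ B : Finset (List β), B.card ≤ S.card ∧ ∀ w, IsBranching (S : Set (List β)) w → w ∈ B := by
  classical
  induction S using Finset.induction_on with
  | empty => exact ⟨∅, by simp, fun w ⟨a, b, _, ⟨y, hy, _⟩, _⟩ => by simp at hy⟩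
  | insert y S hy ih =>
    obtain ⟨B, hB, hmem⟩ := ih
    have leaves : ∀ w, IsBranching (insert y S : Finset (List β)) w →
        ¬ IsBranching (S : Set (List β)) w →
        ∃ a b, a ≠ b ∧ w ++ [a] <+: y ∧ ∃ z ∈ S, w ++ [b] <+: z := by
      rintro w ⟨a, b, hab, ⟨y₁, hy₁, ha⟩, ⟨y₂, hy₂, hb⟩⟩ hnot
      rw [Finset.mem_coe, Finset.mem_insert] at hy₁ hy₂
      rcases hy₁ with rfl | hy₁ <;> rcases hy₂ with rfl | hy₂
      · exact absurd (eq_of_append_singleton_prefix ha hb) hab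
      · exact ⟨a, b, hab, ha, y₂, hy₂, hb⟩
      · exact ⟨b, a, hab.symm, hb, y₁, hy₁, ha⟩
      · exact absurd ⟨a, b, hab, ⟨y₁, hy₁, ha⟩, ⟨y₂, hy₂, hb⟩⟩ hnot
    have uniq : ∀ w w', IsBranching (insert y S : Finset (List β)) w →
        ¬ IsBranching (S : Set (List β)) w → IsBranching (insert y S : Finset (List β)) w' →
        ¬ IsBranching (S : Set (List β)) w' → ¬ w.length < w'.length := by
      intro w w' h1 h2 h3 h4 hlt
      obtain ⟨a, b, hab, ha, z, hz, hb⟩ := leaves w h1 h2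
      obtain ⟨a', b', -, ha', z', hz', hb'⟩ := leaves w' h3 h4
      refine h2 ⟨a, b, hab, ⟨z', hz', ?_⟩, ⟨z, hz, hb⟩⟩
      exact (List.prefix_of_prefix_length_le ha (prefix_of_append_singleton ha')
        (by simpa using hlt)).trans (prefix_of_append_singleton hb')
    by_cases hnew : ∃ w, IsBranching (insert y S : Finset (List β)) w ∧
        ¬ IsBranching (S : Set (List β)) w
    · obtain ⟨w, h1, h2⟩ := hnew
      refine ⟨insert w B, ?_, fun w' h3 => ?_⟩
      · rw [Finset.card_insert_of_notMem hy]
        exact (Finset.card_insert_le _ _).trans (by omega)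
      · by_cases h4 : IsBranching (S : Set (List β)) w'
        · exact Finset.mem_insert_of_mem (hmem w' h4)
        · have hlen : w'.length = w.length :=
            le_antisymm (not_lt.1 (uniq w w' h1 h2 h3 h4)) (not_lt.1 (uniq w' w h3 h4 h1 h2))
          obtain ⟨a, b, -, ha, -⟩ := leaves w h1 h2
          obtain ⟨a', b', -, ha', -⟩ := leaves w' h3 h4
          rw [(List.prefix_of_prefix_length_le (prefix_of_append_singleton ha')
            (prefix_of_append_singleton ha) hlen.le).eq_of_length hlen]
          exact Finset.mem_insert_self _ _
    · push Not at hnew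
      exact ⟨B, hB.trans (Finset.card_le_card (Finset.subset_insert _ _)),
        fun w hw => hmem w (hnew w hw)⟩

theorem length_marked (T : List α) : (marked T).length = T.length + 1 := by simp [marked]

/-- A suffix tree has linearly many nodes. -/
theorem exists_finset_isNode (T : List α) :
    ∃ N : Finset (List (Option α)), (∀ v, v ∈ N ↔ IsNode T v) ∧
      N.card ≤ 2 * (T.length + 2) := by
  classical
  set S := (marked T).tails.toFinset with hS
  have hcard : S.card ≤ T.length + 2 := by
    refine (List.toFinset_card_le _).trans ?_
    rw [List.length_tails, length_marked]
  obtain ⟨B, hB, hmem⟩ := exists_finset_isBranching S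
  have hmemS : ∀ v, v ∈ (S : Set (List (Option α))) ↔ v <:+ marked T := by
    intro v; simp [hS]
  refine ⟨(S ∪ B).filter (IsNode T), fun v => ?_, ?_⟩
  · rw [Finset.mem_filter, and_iff_right_iff_imp, Finset.mem_union]
    rintro (h | ⟨a, b, hab, ha, hb⟩)
    · exact Or.inl ((hmemS v).2 h)
    · obtain ⟨y, hy, hys⟩ := List.infix_iff_prefix_suffix.1 ha
      obtain ⟨z, hz, hzs⟩ := List.infix_iff_prefix_suffix.1 hb
      exact Or.inr (hmem v ⟨a, b, hab, ⟨y, (hmemS y).2 hys, hy⟩, ⟨z, (hmemS z).2 hzs, hz⟩⟩)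
  · refine (Finset.card_filter_le _ _).trans ((Finset.card_union_le _ _).trans ?_)
    omega

theorem IsNode.infix {T : List α} {v : List (Option α)} (h : IsNode T v) : v <:+: marked T := by
  rcases h with h | ⟨a, _, _, h, _⟩
  · exact h.isInfix
  · exact (List.prefix_append v [a]).isInfix.trans h

theorem isNode_nil (T : List α) : IsNode T [] := Or.inl List.nil_suffix

theorem IsNode.length_le {T : List α} {v : List (Option α)} (h : IsNode T v) :
    v.length ≤ T.length + 1 := by
  simpa [length_marked] using h.infix.length_le

/-- A node occurs in the marked text at a place that leaves room for it. -/
theorem IsNode.exists_occursAt {T : List α} {v : List (Option α)} (h : IsNode T v) :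
    ∃ i, i + v.length ≤ T.length + 1 ∧ OccursAt v (marked T) i := by
  obtain ⟨s, t, hst⟩ := h.infix
  refine ⟨s.length, ?_, t, ?_⟩
  · rw [← length_marked, ← hst]; simp
  · rw [← hst]; simp

/-- `v` is the node at which the search for the string `w` ends. In contrast to `IsLocus`, the
string may contain the end marker. -/
def IsStringLocus (T : List α) (w v : List (Option α)) : Prop :=
  IsNode T v ∧ w <+: v ∧ ∀ u, IsNode T u → w <+: u → v <+: u

theorem IsStringLocus.unique {T : List α} {w v v' : List (Option α)} (h : IsStringLocus T w v)
    (h' : IsStringLocus T w v') : v = v' :=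
  (h.2.2 v' h'.1 h'.2.1).eq_of_length
    (le_antisymm (h.2.2 v' h'.1 h'.2.1).length_le (h'.2.2 v h.1 h.2.1).length_le)

theorem exists_diverge {u v : List β} (huv : ¬ u <+: v) (hvu : ¬ v <+: u) :
    ∃ w a b, a ≠ b ∧ w ++ [a] <+: u ∧ w ++ [b] <+: v := by
  induction u generalizing v with
  | nil => exact absurd List.nil_prefix huv
  | cons x u ih =>
    cases v with
    | nil => exact absurd List.nil_prefix hvu
    | cons y v =>
      by_cases hxy : x = y
      · subst hxy
        obtain ⟨w, a, b, hab, ha, hb⟩ := ih (fun h => huv (List.cons_prefix_cons.2 ⟨rfl, h⟩))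
          (fun h => hvu (List.cons_prefix_cons.2 ⟨rfl, h⟩))
        exact ⟨x :: w, a, b, hab, List.cons_prefix_cons.2 ⟨rfl, ha⟩,
          List.cons_prefix_cons.2 ⟨rfl, hb⟩⟩
      · exact ⟨[], x, y, hxy, by simp, by simp⟩

theorem exists_isStringLocus {T : List α} {w : List (Option α)} (h : w <:+: marked T) :
    ∃ v, IsStringLocus T w v := by
  classical
  have hex : ∃ l, ∃ v, IsNode T v ∧ w <+: v ∧ v.length = l := by
    obtain ⟨t, ht, hts⟩ := List.infix_iff_prefix_suffix.1 h
    exact ⟨_, t, Or.inl hts, ht, rfl⟩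
  obtain ⟨v, hv, hwv, hl⟩ := Nat.find_spec hex
  refine ⟨v, hv, hwv, fun u hu hwu => ?_⟩
  have hmin : ∀ u', IsNode T u' → w <+: u' → v.length ≤ u'.length := fun u' h1 h2 =>
    hl ▸ Nat.find_min' hex ⟨u', h1, h2, rfl⟩
  by_contra hvu
  have huv : ¬ u <+: v := fun h => hvu (by rw [h.eq_of_length_le (hmin u hu hwu)])
  -- the node at which `u` and `v` part would be higher than `v`
  obtain ⟨c, a, b, hab, ha, hb⟩ := exists_diverge hvu huv
  have hc : IsNode T c := Or.inr ⟨a, b, hab, ha.isInfix.trans hv.infix, hb.isInfix.trans hu.infix⟩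
  have hclt : c.length < v.length := by simpa using ha.length_le
  have hwc : ¬ w <+: c := fun h => by have := hmin c hc h; omega
  have hcv := prefix_of_append_singleton ha
  have hcw : c.length < w.length := by
    by_contra hle
    exact hwc (List.prefix_of_prefix_length_le hwv hcv (not_lt.1 hle))
  have h1 : c ++ [a] <+: w := List.prefix_of_prefix_length_le ha hwv (by simpa using hcw)
  have h2 : c ++ [b] <+: w := List.prefix_of_prefix_length_le hb hwu (by simpa using hcw)
  exact hab (eq_of_append_singleton_prefix h1 h2)

theorem map_some_infix_marked {T x : List α} (h : x <:+: T) : x.map some <:+: marked T :=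
  (h.map some).trans (List.prefix_append _ _).isInfix

theorem exists_isLocus {T x : List α} (h : x <:+: T) : ∃ v, IsLocus T x v :=
  exists_isStringLocus (map_some_infix_marked h)

/-- A node is entered by at most one letter from at most one parent. -/
theorem eq_of_isStringLocus_append {T : List α} {u u' v : List (Option α)} {c c' : Option α}
    (hu : IsNode T u) (hu' : IsNode T u') (h : IsStringLocus T (u ++ [c]) v)
    (h' : IsStringLocus T (u' ++ [c']) v) : u = u' ∧ c = c' := by
  -- otherwise the longer of `u` and `u'` would be a node between the other one and `v`
  have key : ∀ a a' : List (Option α), ∀ b b', IsNode T a' → IsStringLocus T (a ++ [b]) v →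
      IsStringLocus T (a' ++ [b']) v → ¬ a.length < a'.length := by
    intro a a' b b' ha' hab hab' hlt
    have h1 := hab.2.2 a' ha' (List.prefix_of_prefix_length_le hab.2.1
      (prefix_of_append_singleton hab'.2.1) (by simpa using hlt))
    have h2 := hab'.2.1.length_le
    have h3 := h1.length_le
    simp at h2; omega
  have hlen : u.length = u'.length :=
    le_antisymm (not_lt.1 (key u' u c' c hu h' h)) (not_lt.1 (key u u' c c' hu' h h'))
  have := (List.prefix_of_prefix_length_le h.2.1 h'.2.1 (by simp [hlen])).eq_of_length
    (by simp [hlen])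
  simpa using List.append_inj this hlen

/-- One step of the search for `P`: a node `u` above the locus `L` of `P` that is still too short
has a child, entered by the next letter of `P`, that is above or equal to `L`. -/
theorem IsLocus.step {T P : List α} {L u : List (Option α)} (hL : IsLocus T P L)
    (huL : u <+: L) {c : α} (hc : P[u.length]? = some c) :
    ∃ v, IsStringLocus T (u ++ [some c]) v ∧ v <+: L ∧ u.length < v.length := by
  obtain ⟨hlt, hget⟩ := List.getElem?_eq_some_iff.1 hc
  have hPL := hL.2.1
  have hucP : u ++ [some c] <+: P.map some := by
    refine prefix_of_getElem? fun i hi => ?_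
    simp only [List.length_append, List.length_singleton] at hi
    by_cases hiu : i < u.length
    · rw [List.getElem?_append_left hiu, ← getElem?_eq_of_prefix huL hiu]
      exact (getElem?_eq_of_prefix hPL (by simp; omega)).symm
    · obtain rfl : i = u.length := by omega
      simp [hlt, hget]
  have hucL := hucP.trans hPL
  obtain ⟨v, hv⟩ := exists_isStringLocus (hucL.isInfix.trans hL.1.infix)
  exact ⟨v, hv, hv.2.2 L hL.1 hucL, by simpa using hv.2.1.length_le⟩

theorem IsLocus.eq_of_length_le {T P : List α} {L u : List (Option α)} (hL : IsLocus T P L)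
    (hu : IsNode T u) (huL : u <+: L) (hlen : P.length ≤ u.length) : u = L := by
  have hPu : P.map some <+: u :=
    List.prefix_of_prefix_length_le hL.2.1 huL (by simpa using hlen)
  exact huL.eq_of_length_le (hL.2.2 u hu hPu).length_le

theorem IsParent.unique {T : List α} {u u' v : List (Option α)} (h : IsParent T u v)
    (h' : IsParent T u' v) : u = u' := by
  obtain ⟨h1, -, h2, h3, h4⟩ := h
  obtain ⟨h1', -, h2', h3', h4'⟩ := h'
  exact (h4' u h1 h2 h3).eq_of_length_le (h4 u' h1' h2' h3').length_le

end SuffixTree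

/-! ### Period sequences -/

section PeriodSequences

variable {α : Type*}

theorem length_substr {T : List α} {s e : ℕ} (he : e < T.length) :
    (substr T s e).length = e + 1 - s := by
  simp [substr]; omega

theorem getElem?_substr (T : List α) {s e i : ℕ} (hi : i < e + 1 - s) :
    (substr T s e)[i]? = T[s + i]? := by
  rw [substr, List.getElem?_take_of_lt hi, List.getElem?_drop]

theorem substr_prefix_drop (T : List α) (s e : ℕ) : substr T s e <+: T.drop s :=
  List.take_prefix _ _

theorem prefix_drop_infix {x T : List α} {i : ℕ} (h : x <+: T.drop i) : x <:+: T :=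
  List.infix_iff_prefix_suffix.2 ⟨_, h, List.drop_suffix _ _⟩

theorem isPeriod_substr_iff {T p : List α} {s e : ℕ} (he : e < T.length) :
    IsPeriod p (substr T s e) ↔ p ≠ [] ∧ p.length ≤ e + 1 - s ∧
      (∀ i < p.length, T[s + i]? = p[i]?) ∧
      ∀ i, i + p.length < e + 1 - s → T[s + i]? = T[s + (i + p.length)]? := by
  rw [isPeriod_iff, PerOn, length_substr he]
  refine and_congr_right fun _ => ⟨fun ⟨h1, h2⟩ => ?_, fun ⟨h1, h2, h3⟩ => ?_⟩
  · have h3 := h1.length_le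
    rw [length_substr he] at h3
    refine ⟨h3, fun i hi => ?_, fun i hi => ?_⟩
    · rw [← getElem?_substr T (e := e) (by omega), getElem?_eq_of_prefix h1 hi]
    · have := h2 i hi
      rwa [getElem?_substr T (by omega), getElem?_substr T (by omega)] at this
  · refine ⟨prefix_of_getElem? fun i hi => ?_, fun i hi => ?_⟩
    · rw [getElem?_substr T (by omega), h2 i hi]
    · rw [getElem?_substr T (by omega), getElem?_substr T (by omega), h3 i hi]

/-- Two period sequences of the same period that share at least `|p|` positions are equal, because
their union has the period `p`. -/
theorem IsPeriodSequence.eq_of_overlap {T p : List α} {s e s' e' : ℕ}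
    (h : IsPeriodSequence T p s e) (h' : IsPeriodSequence T p s' e') (hs : s ≤ s')
    (hov : s' + p.length ≤ e + 1) : s = s' ∧ e = e' := by
  obtain ⟨hse, he, hp, hlen, hmax⟩ := h
  obtain ⟨hse', he', hp', hlen', hmax'⟩ := h'
  by_cases hee : e' ≤ e
  · exact hmax' s e hs hee he hp.1
  · have hunion : IsPeriod p (substr T s e') := by
      have h1 := (isPeriod_substr_iff he).1 hp.1
      have h2 := (isPeriod_substr_iff he').1 hp'.1
      refine (isPeriod_substr_iff he').2 ⟨h1.1, by omega, h1.2.2.1, fun i hi => ?_⟩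
      by_cases hc : i + p.length < e + 1 - s
      · exact h1.2.2.2 i hc
      · have := h2.2.2.2 (s + i - s') (by omega)
        rw [show s' + (s + i - s') = s + i by omega,
          show s' + (s + i - s' + p.length) = s + (i + p.length) by omega] at this
        exact this
    have h1 := hmax s e' le_rfl (by omega) he' hunion
    have h2 := hmax' s e' hs le_rfl he' hunion
    omega

theorem IsPeriodSequence.period_unique {T p q : List α} {s e : ℕ} (hp : IsPeriodSequence T p s e)
    (hq : IsPeriodSequence T q s e) : p = q := hp.2.2.1.eq hq.2.2.1

theorem IsPeriodSequence.end_unique {T p : List α} {s e e' : ℕ} (h : IsPeriodSequence T p s e)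
    (h' : IsPeriodSequence T p s e') : e = e' :=
  (h.eq_of_overlap h' le_rfl (by have := h.2.2.2.1; omega)).2

/-- Only logarithmically many period sequences start at the same position. -/
theorem card_ends_le {T : List α} {s : ℕ} {S : Finset ℕ}
    (hS : ∀ e ∈ S, ∃ p, IsPeriodSequence T p s e) :
    S.card ≤ 2 * (Nat.log 2 T.length + 1) := by
  classical
  choose! per hper using hS
  have hinj : Set.InjOn (fun e => (per e).length) S := by
    intro e he e' he' hlen
    have h := hper e he
    have h' := hper e' he'
    have heq : per e = per e' :=
      (List.prefix_of_prefix_length_le (h.2.2.1.1.isPrefix.trans (substr_prefix_drop T s e))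
        (h'.2.2.1.1.isPrefix.trans (substr_prefix_drop T s e')) (le_of_eq hlen)).eq_of_length hlen
    rw [← heq] at h'
    exact h.end_unique h'
  rw [← Finset.card_image_of_injOn hinj]
  refine card_le_of_subset_periodLengths (v := T.drop s) (fun d hd => ?_) (by simp)
  obtain ⟨e, he, rfl⟩ := Finset.mem_image.1 hd
  have h := hper e he
  refine h.2.2.1.mem_periodLengths ?_ (substr_prefix_drop T s e)
  rw [length_substr h.2.1]
  exact h.2.2.2.1

theorem exists_finset_isPeriodSequence (T : List α) :
    ∃ R : Finset (ℕ × ℕ), (∀ x, x ∈ R ↔ ∃ p, IsPeriodSequence T p x.1 x.2) ∧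
      R.card ≤ 2 * (Nat.log 2 T.length + 1) * T.length := by
  classical
  refine ⟨(Finset.range T.length ×ˢ Finset.range T.length).filter
    fun x => ∃ p, IsPeriodSequence T p x.1 x.2, fun x => ?_, ?_⟩
  · rw [Finset.mem_filter, and_iff_right_iff_imp]
    rintro ⟨p, h⟩
    have h1 := h.1
    have h2 := h.2.1
    simp only [Finset.mem_product, Finset.mem_range]
    omega
  · refine (Finset.card_le_mul_card_image_of_maps_to (f := Prod.fst) (t := Finset.range T.length)
      (fun x hx => ?_) (2 * (Nat.log 2 T.length + 1)) fun s _ => ?_).trans (by simp)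
    · exact (Finset.mem_product.1 (Finset.mem_filter.1 hx).1).1
    · have hinj : Set.InjOn Prod.snd (((Finset.range T.length ×ˢ Finset.range T.length).filter
          fun x => ∃ p, IsPeriodSequence T p x.1 x.2).filter fun x => x.1 = s : Set (ℕ × ℕ)) := by
        intro x hx y hy hxy
        simp only [Finset.coe_filter, Finset.mem_filter, Set.mem_ofPred_eq] at hx hy
        exact Prod.ext (hx.2.trans hy.2.symm) hxy
      rw [← Finset.card_image_of_injOn hinj]
      refine card_ends_le (T := T) (s := s) fun e he => ?_
      obtain ⟨x, hx, rfl⟩ := Finset.mem_image.1 he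
      rw [Finset.mem_filter, Finset.mem_filter] at hx
      obtain ⟨⟨-, p, hp⟩, rfl⟩ := hx
      exact ⟨p, hp⟩

/-- The period sequences of a pattern are the sufficiently long ones of its period path. -/
theorem mem_periodSequencesOf_iff {T p P : List α} (hp : IsShortestPeriod p P) (x : ℕ × ℕ) :
    x ∈ periodSequencesOf T P ↔ IsPeriodSequence T p x.1 x.2 ∧ P.length ≤ seqLength x := by
  constructor
  · rintro ⟨q, hq, hx, hP⟩
    obtain rfl := hp.eq hq
    refine ⟨hx, ?_⟩
    have := hP.length_le
    rwa [length_substr hx.2.1] at this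
  · rintro ⟨hx, hP⟩
    refine ⟨p, hp, hx, hp.1.prefix_of_length_le hx.2.2.1.1 ?_⟩
    rwa [length_substr hx.2.1]

open Classical in
/-- Positions of occurrences that are more than `|P| / 2` apart: grouped by the remainder modulo `3`
of their quotient by `⌈|P| / 2⌉`, they form three sets of non-overlapping occurrences. -/
theorem card_le_three_mul_occNO {T P : List α} (hP : P ≠ []) {A : Finset ℕ}
    (hocc : ∀ a ∈ A, a < T.length ∧ OccursAt P T a)
    (hsep : ∀ a ∈ A, ∀ b ∈ A, a < b → P.length < 2 * (b - a)) : A.card ≤ 3 * occNO T P := by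
  have hm := List.length_pos_iff.2 hP
  obtain ⟨h, hh⟩ : ∃ h, h = (P.length + 1) / 2 := ⟨_, rfl⟩
  have hsub : A ⊆ (Finset.range 3).biUnion fun r => A.filter fun a => a / h % 3 = r := by
    intro a ha
    simp only [Finset.mem_biUnion, Finset.mem_range, Finset.mem_filter]
    exact ⟨_, Nat.mod_lt _ (by norm_num), ha, rfl⟩
  refine (Finset.card_le_card hsub).trans (Finset.card_biUnion_le.trans ?_)
  refine (Finset.sum_le_card_nsmul _ _ (occNO T P) fun r _ => ?_).trans (by simp)
  unfold occNO
  refine Finset.le_sup (f := Finset.card) ?_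
  simp only [Finset.mem_filter, Finset.mem_powerset]
  refine ⟨fun a ha => ?_, fun a ha => (hocc a ha.1).2, fun a ha b hb hab => ?_⟩
  · exact Finset.mem_range.2 (hocc a (Finset.mem_filter.1 ha).1).1
  · have h1 := hsep a ha.1 b hb.1 hab
    have hpos : 0 < h := by omega
    have h2 : a / h + 1 ≤ b / h := by
      rw [← Nat.add_div_right a hpos]
      exact Nat.div_le_div_right (by omega)
    have h3 : a / h + 3 ≤ b / h := by omega
    have h4 := Nat.div_add_mod a h
    have h5 := Nat.mod_lt a hpos
    have h6 := Nat.mul_div_le b h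
    have h7 := Nat.mul_le_mul_left h h3
    rw [mul_add] at h7
    omega

/-- There are at most three times as many period sequences of `P` as non-overlapping occurrences,
since two of them share less than `|P| / 2` positions. -/
theorem length_le_three_mul_occNO {T p P : List α} (hp : IsShortestPeriod p P)
    (hlen : 2 * p.length < P.length) {L : List (ℕ × ℕ)} (hL : L.Nodup)
    (hmem : ∀ x ∈ L, x ∈ periodSequencesOf T P) : L.length ≤ 3 * occNO T P := by
  classical
  have hrun : ∀ x ∈ L, IsPeriodSequence T p x.1 x.2 ∧ P.length ≤ seqLength x :=
    fun x hx => (mem_periodSequencesOf_iff hp x).1 (hmem x hx)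
  have hinj : Set.InjOn Prod.fst (L.toFinset : Set (ℕ × ℕ)) := by
    intro x hx y hy hxy
    have h1 := (hrun x (List.mem_toFinset.1 hx)).1
    have h2 := (hrun y (List.mem_toFinset.1 hy)).1
    rw [hxy] at h1
    exact Prod.ext hxy (h1.end_unique h2)
  rw [← List.toFinset_card_of_nodup hL, ← Finset.card_image_of_injOn hinj]
  refine card_le_three_mul_occNO (by rintro rfl; simp at hlen) (fun a ha => ?_)
    fun a ha b hb hab => ?_
  · obtain ⟨x, hx, rfl⟩ := Finset.mem_image.1 ha
    obtain ⟨q, -, h1, h2⟩ := hmem x (List.mem_toFinset.1 hx)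
    exact ⟨h1.1.trans_lt h1.2.1, h2.trans (substr_prefix_drop _ _ _)⟩
  · obtain ⟨x, hx, rfl⟩ := Finset.mem_image.1 ha
    obtain ⟨y, hy, rfl⟩ := Finset.mem_image.1 hb
    obtain ⟨h1, h1'⟩ := hrun x (List.mem_toFinset.1 hx)
    obtain ⟨h2, -⟩ := hrun y (List.mem_toFinset.1 hy)
    have h3 : ¬ y.1 + p.length ≤ x.2 + 1 := fun h => by
      have := (h1.eq_of_overlap h2 hab.le h).1
      omega
    unfold seqLength at h1'
    omega

/-! ### Period paths and the edges of the suffix tree -/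

theorem length_of_mem_periodPath {T p x : List α} (h : x ∈ periodPath T p) :
    2 * p.length < x.length := by
  obtain ⟨q, hq, hlen⟩ := h.2.1.exists_isShortestPeriod
  rwa [h.2.2.eq hq]

theorem prefix_of_map_some_prefix {x y : List α} {v : List (Option α)} (hx : x.map some <+: v)
    (hy : y.map some <+: v) (hle : x.length ≤ y.length) : x <+: y := by
  have h := (List.prefix_of_prefix_length_le hx hy (by simpa using hle)).filterMap id
  simpa [List.filterMap_map] using h

/-- The pointer into a list does not depend on the chosen place of the edge: a period sequence with
a length between `|x|` and `|x'|` would end at a branching node between `x` and `x'`. -/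
theorem seqLength_lt_iff_of_isLocus {T p x x' : List α} {v : List (Option α)}
    (hx : x ∈ periodPath T p) (hx' : x' ∈ periodPath T p) (hv : IsLocus T x v)
    (hv' : IsLocus T x' v) {y : ℕ × ℕ} (hy : IsPeriodSequence T p y.1 y.2) :
    seqLength y < x.length ↔ seqLength y < x'.length := by
  have key : ∀ x x' : List α, x ∈ periodPath T p → x' ∈ periodPath T p → IsLocus T x v →
      IsLocus T x' v → x.length ≤ seqLength y → ¬ seqLength y < x'.length := by
    clear hx hx' hv hv' x x'
    intro x x' hx hx' hv hv' hle hlt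
    obtain ⟨hse, he, hp, hlen, hmax⟩ := hy
    set w := substr T y.1 y.2 with hw
    have hwlen : w.length = seqLength y := length_substr he
    have hxw : x <+: w := hx.2.2.1.prefix_of_length_le hp.1 (by omega)
    have hwx' : w <+: x' := hp.1.prefix_of_length_le hx'.2.2.1 (by omega)
    obtain ⟨c, hc⟩ : ∃ c, x'[w.length]? = some c :=
      ⟨_, List.getElem?_eq_getElem (by omega)⟩
    have hwc : w ++ [c] <+: x' := by
      refine prefix_of_getElem? fun i hi => ?_
      simp only [List.length_append, List.length_singleton] at hi
      by_cases hiw : i < w.length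
      · rw [List.getElem?_append_left hiw, getElem?_eq_of_prefix hwx' hiw]
      · obtain rfl : i = w.length := by omega
        simp [hc]
    -- the letter that follows the period sequence, or the end marker
    obtain ⟨d, hd⟩ : ∃ d, (marked T)[y.2 + 1]? = some d :=
      ⟨_, List.getElem?_eq_getElem (by rw [length_marked]; omega)⟩
    have hdc : some c ≠ d := by
      rintro rfl
      have hTc : T[y.2 + 1]? = some c := by
        rw [marked] at hd
        by_cases hend : y.2 + 1 < T.length
        · rw [List.getElem?_append_left (by simpa using hend)] at hd
          simpa using hd
        · rw [List.getElem?_append_right (by simpa using hend)] at hd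
          simp only [List.length_map] at hd
          rw [show y.2 + 1 - T.length = 0 by omega] at hd
          simp at hd
      have hend : y.2 + 1 < T.length := (List.getElem?_eq_some_iff.1 hTc).1
      have hext : substr T y.1 (y.2 + 1) = w ++ [c] := by
        rw [hw, substr, substr, show y.2 + 1 + 1 - y.1 = y.2 + 1 - y.1 + 1 by omega,
          List.take_add_one, List.getElem?_drop,
          show y.1 + (y.2 + 1 - y.1) = y.2 + 1 by omega, hTc]
        rfl
      have := (hmax y.1 (y.2 + 1) le_rfl (by omega) hend
        (hext ▸ hx'.2.2.1.of_prefix hwc (by simp; unfold seqLength at hwlen; omega))).2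
      omega
    have hwd : w.map some ++ [d] <:+: marked T := by
      refine List.infix_iff_prefix_suffix.2 ⟨(marked T).drop y.1, ?_, List.drop_suffix _ _⟩
      refine prefix_of_getElem? fun i hi => ?_
      simp only [List.length_append, List.length_map, List.length_singleton, hwlen] at hi
      unfold seqLength at hwlen hi
      rw [List.getElem?_drop]
      by_cases hiw : i < y.2 + 1 - y.1
      · rw [List.getElem?_append_left (by simpa [hwlen] using hiw), List.getElem?_map, hw,
          getElem?_substr T hiw, marked, List.getElem?_append_left (by simp; omega),
          List.getElem?_map]
      · rw [show y.1 + i = y.2 + 1 by omega, hd, List.getElem?_append_right (by simp; omega)]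
        simp [show i - w.length = 0 by omega]
    have hnode : IsNode T (w.map some) := by
      refine Or.inr ⟨some c, d, hdc, ?_, hwd⟩
      have h := map_some_infix_marked (hwc.isInfix.trans hx'.1)
      simpa using h
    have h1 := (hv.2.2 _ hnode (hxw.map some)).length_le
    have h2 := hv'.2.1.length_le
    simp only [List.length_map] at h1 h2
    omega
  constructor
  · intro h
    by_contra hcon
    exact key x' x hx' hx hv' hv (not_lt.1 hcon) h
  · intro h
    by_contra hcon
    exact key x x' hx hx' hv hv' (not_lt.1 hcon) h

/-- `l` is the length of the longest place of the period path of `p` that is `v` or lies inside the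
edge that enters `v`. -/
def IsPathEnd (T : List α) (v : List (Option α)) (p : List α) (l : ℕ) : Prop :=
  (∃ x ∈ periodPath T p, IsLocus T x v ∧ x.length = l) ∧
    ∀ x ∈ periodPath T p, IsLocus T x v → x.length ≤ l

theorem IsPathEnd.period_unique {T p q : List α} {v : List (Option α)} {l : ℕ}
    (hp : IsPathEnd T v p l) (hq : IsPathEnd T v q l) : p = q := by
  obtain ⟨⟨x, hx, hxv, hxl⟩, -⟩ := hp
  obtain ⟨⟨y, hy, hyv, hyl⟩, -⟩ := hq
  obtain rfl : x = y := (prefix_of_map_some_prefix hxv.2.1 hyv.2.1 (by omega)).eq_of_length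
    (by omega)
  exact hx.2.2.eq hy.2.2

theorem exists_isPathEnd {T p x : List α} {v : List (Option α)} (hx : x ∈ periodPath T p)
    (hv : IsLocus T x v) : ∃ l, IsPathEnd T v p l ∧ x.length ≤ l := by
  classical
  have hex : ∃ d, ∃ y ∈ periodPath T p, IsLocus T y v ∧ v.length - y.length = d :=
    ⟨_, x, hx, hv, rfl⟩
  obtain ⟨y, hy, hyv, hd⟩ := Nat.find_spec hex
  have hle : ∀ z ∈ periodPath T p, IsLocus T z v → z.length ≤ y.length := by
    intro z hz hzv
    have h1 := Nat.find_min' hex ⟨z, hz, hzv, rfl⟩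
    have h2 := hzv.2.1.length_le
    have h3 := hyv.2.1.length_le
    simp only [List.length_map] at h2 h3
    omega
  exact ⟨y.length, ⟨⟨y, hy, hyv, rfl⟩, hle⟩, hle x hx hv⟩

theorem IsPathEnd.le_length {T p : List α} {v : List (Option α)} {l : ℕ}
    (h : IsPathEnd T v p l) : l ≤ v.length := by
  obtain ⟨⟨x, -, hv, rfl⟩, -⟩ := h
  simpa using hv.2.1.length_le

theorem mem_periodLengths_map_some {v : List α} {d : ℕ} (h : d ∈ periodLengths v) :
    d ∈ periodLengths (v.map some) := by
  have key : ∀ g N, PerOn (v.map some) g N ↔ PerOn v g N := by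
    intro g N
    simp only [PerOn, List.getElem?_map]
    exact forall₂_congr fun i _ => (Option.map_injective (Option.some_injective α)).eq_iff
  simpa [periodLengths, key] using h

theorem periodLengths_mono {v w : List α} (h : v <+: w) : periodLengths v ⊆ periodLengths w := by
  rintro d ⟨hd, N, hN, hdN, hper, hmin⟩
  exact ⟨hd, N, hN.trans h.length_le, hdN, (perOn_of_prefix h hN).2 hper,
    fun g hg hg' => hmin g hg ((perOn_of_prefix h hN).1 hg')⟩

/-- Only logarithmically many period paths meet an edge. -/
theorem exists_finset_isPathEnd (T : List α) (v : List (Option α))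
    (hv : v.length ≤ T.length + 1) :
    ∃ E : Finset ℕ, (∀ l, l ∈ E ↔ ∃ p, IsPathEnd T v p l) ∧
      E.card ≤ 2 * (Nat.log 2 (T.length + 1) + 1) := by
  classical
  refine ⟨(Finset.range (T.length + 2)).filter fun l => ∃ p, IsPathEnd T v p l, fun l => ?_, ?_⟩
  · rw [Finset.mem_filter, and_iff_right_iff_imp]
    rintro ⟨p, h⟩
    have := h.le_length
    exact Finset.mem_range.2 (by omega)
  · set E := (Finset.range (T.length + 2)).filter fun l => ∃ p, IsPathEnd T v p l
    have hE : ∀ l ∈ E, ∃ p, IsPathEnd T v p l := fun l hl => (Finset.mem_filter.1 hl).2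
    choose! per hper using hE
    have hpre : ∀ l ∈ E, (per l).map some <+: v := by
      intro l hl
      obtain ⟨⟨x, hx, hxv, -⟩, -⟩ := hper l hl
      exact (hx.2.2.1.isPrefix.map some).trans hxv.2.1
    have hinj : Set.InjOn (fun l => (per l).length) E := by
      intro l hl l' hl' hlen
      have heq : per l = per l' :=
        (prefix_of_map_some_prefix (hpre l hl) (hpre l' hl') (le_of_eq hlen)).eq_of_length hlen
      obtain ⟨⟨x, hx, hxv, rfl⟩, hle⟩ := hper l hl
      obtain ⟨⟨x', hx', hxv', rfl⟩, hle'⟩ := hper l' hl'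
      rw [← heq] at hx' hle'
      exact le_antisymm (hle' x hx hxv) (hle x' hx' hxv')
    rw [← Finset.card_image_of_injOn hinj]
    refine card_le_of_subset_periodLengths (v := v) (fun d hd => ?_) hv
    obtain ⟨l, hl, rfl⟩ := Finset.mem_image.1 hd
    obtain ⟨⟨x, hx, hxv, -⟩, -⟩ := hper l hl
    exact periodLengths_mono hxv.2.1 (mem_periodLengths_map_some
      (hx.2.2.mem_periodLengths (length_of_mem_periodPath hx) List.prefix_rfl))

/-- Along an edge the shortest period grows, and so the period path of `P` is the first one that
ends at or below `P`. -/
theorem isPathEnd_of_first {T p P : List α} {v : List (Option α)} {l : ℕ}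
    (hP : P ∈ periodPath T p) (hv : IsLocus T P v) (hl : ∃ q, IsPathEnd T v q l)
    (hPl : P.length ≤ l)
    (hfirst : ∀ l', (∃ q, IsPathEnd T v q l') → P.length ≤ l' → l ≤ l') :
    IsPathEnd T v p l := by
  obtain ⟨q, hq⟩ := hl
  obtain ⟨lp, hlp, hPlp⟩ := exists_isPathEnd hP hv
  obtain ⟨x, hx, hxv, rfl⟩ := hq.1
  obtain ⟨y, hy, hyv, rfl⟩ := hlp.1
  have hPx : P <+: x := prefix_of_map_some_prefix hv.2.1 hxv.2.1 hPl
  have hxy : x <+: y := prefix_of_map_some_prefix hxv.2.1 hyv.2.1 (hfirst _ ⟨p, hlp⟩ hPlp)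
  have hlenP := length_of_mem_periodPath hP
  have hpx : IsPeriod p x := hy.2.2.1.of_prefix hxy (by omega)
  have h1 : q.length ≤ p.length := hx.2.2.2 p hpx
  have hqP : IsPeriod q P := hx.2.2.1.of_prefix hPx (by omega)
  have hqs : IsShortestPeriod q P := ⟨hqP, fun r hr => h1.trans (hP.2.2.2 r hr)⟩
  rwa [hP.2.2.eq hqs]

end PeriodSequences

/-! ### Blocks of words in an array -/

section Blocks

variable {ι : Type*}

/-- Blocks of prescribed lengths `w i` can be stored one after the other; the addresses depend only
on the lengths, and so the contents of the blocks may refer to them. -/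
theorem exists_layout (w : ι → ℕ) (l : List ι) :
    ∃ off : ι → ℕ, (∀ i ∈ l, off i + w i ≤ (l.map w).sum) ∧
      (∀ i ∈ l, ∀ j ∈ l, i ≠ j → off i + w i ≤ off j ∨ off j + w j ≤ off i) ∧
      ∀ blk : ι → List ℕ, (∀ i ∈ l, (blk i).length = w i) →
        (l.flatMap blk).length = (l.map w).sum ∧
        ∀ i ∈ l, ∀ j < w i, (l.flatMap blk)[off i + j]? = (blk i)[j]? := by
  classical
  induction l with
  | nil => exact ⟨fun _ => 0, by simp⟩
  | cons a l ih =>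
    obtain ⟨off, h1, h2, h3⟩ := ih
    refine ⟨fun i => if i = a then 0 else w a + off i, ?_, ?_, fun blk hblk => ⟨?_, ?_⟩⟩
    · intro i hi
      by_cases hia : i = a
      · simp [hia]
      · have := h1 i ((List.mem_cons.1 hi).resolve_left hia)
        simp only [hia, if_false, List.map_cons, List.sum_cons]; omega
    · intro i hi j hj hij
      by_cases hia : i = a <;> by_cases hja : j = a
      · exact absurd (hia.trans hja.symm) hij
      · left; simp only [hia, hja, if_true, if_false]; omega
      · right; simp only [hia, hja, if_true, if_false]; omega
      · have := h2 i ((List.mem_cons.1 hi).resolve_left hia) j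
          ((List.mem_cons.1 hj).resolve_left hja) hij
        simp only [hia, hja, if_false]; omega
    · have := (h3 blk fun i hi => hblk i (List.mem_cons_of_mem _ hi)).1
      rw [List.flatMap_cons, List.length_append, this, hblk a List.mem_cons_self, List.map_cons,
        List.sum_cons]
    · intro i hi j hj
      have ha := hblk a List.mem_cons_self
      rw [List.flatMap_cons]
      beta_reduce
      by_cases hia : i = a
      · subst hia
        rw [if_pos rfl, zero_add, List.getElem?_append_left (by omega)]
      · have := (h3 blk fun i hi => hblk i (List.mem_cons_of_mem _ hi)).2 i
          ((List.mem_cons.1 hi).resolve_left hia) j hj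
        rw [if_neg hia, List.getElem?_append_right (by omega), ← this]
        congr 1; omega

end Blocks

/-! ### Perfect hashing -/

/-- The hash functions `x ↦ (a x mod q) mod s`, with `q` prime, form an almost universal family:
two keys collide under few of the multipliers `a`, since in case of a collision `a (x - y) mod q` is
a multiple of `s` or differs from `q` by one. -/
theorem card_collisions_le {q s x y : ℕ} (hq : q.Prime) (hx : x < q) (hy : y < q)
    (hxy : x ≠ y) :
    ((Finset.Ico 1 q).filter fun a => a * x % q % s = a * y % q % s).card ≤
      2 * ((q - 1) / s) := by
  classical
  have hq0 := hq.pos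
  have hco : Nat.Coprime q (x + q - y) := by
    rw [Nat.Prime.coprime_iff_not_dvd hq]
    intro hdvd
    rcases lt_or_gt_of_ne hxy with h | h
    · exact Nat.not_dvd_of_pos_of_lt (by omega) (by omega) hdvd
    · rw [show x + q - y = x - y + q by omega, Nat.dvd_add_self_right] at hdvd
      exact Nat.not_dvd_of_pos_of_lt (by omega) (by omega) hdvd
  have hinj : Set.InjOn (fun a => a * (x + q - y) % q)
      ((Finset.Ico 1 q).filter fun a => a * x % q % s = a * y % q % s : Finset ℕ) := by
    intro a ha b hb hab
    simp only [Finset.coe_filter, Finset.mem_Ico, Set.mem_ofPred_eq] at ha hb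
    have h : a ≡ b [MOD q] := Nat.ModEq.cancel_right_of_coprime hco hab
    rwa [Nat.ModEq, Nat.mod_eq_of_lt ha.1.2, Nat.mod_eq_of_lt hb.1.2] at h
  rw [← Finset.card_image_of_injOn hinj]
  have hsub : (((Finset.Ico 1 q).filter fun a => a * x % q % s = a * y % q % s).image
      fun a => a * (x + q - y) % q) ⊆
      ((Finset.Icc 1 ((q - 1) / s)).image fun j => s * j) ∪
      ((Finset.Icc 1 ((q - 1) / s)).image fun j => q - s * j) := by
    intro c hc
    obtain ⟨a, ha, rfl⟩ := Finset.mem_image.1 hc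
    rw [Finset.mem_filter, Finset.mem_Ico] at ha
    obtain ⟨⟨ha1, haq⟩, hcol⟩ := ha
    have hu : a * x % q < q := Nat.mod_lt _ hq0
    have hw : a * y % q < q := Nat.mod_lt _ hq0
    have hmod : a * (x + q - y) ≡ a * x % q + q - a * y % q [MOD q] := by
      refine Nat.ModEq.add_right_cancel (Nat.mod_modEq (a * y) q).symm ?_
      rw [← mul_add, show x + q - y + y = x + q by omega,
        show a * x % q + q - a * y % q + a * y % q = a * x % q + q by omega, mul_add]
      have h1 : a * x ≡ a * x % q [MOD q] := (Nat.mod_modEq _ _).symm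
      have h2 : a * q ≡ q [MOD q] := by simp [Nat.ModEq]
      exact h1.add h2
    have hne : a * x % q ≠ a * y % q := by
      intro h
      have hca : Nat.Coprime q a :=
        (Nat.Prime.coprime_iff_not_dvd hq).2 (Nat.not_dvd_of_pos_of_lt (by omega) haq)
      have h' : x ≡ y [MOD q] := Nat.ModEq.cancel_left_of_coprime hca h
      rw [Nat.ModEq, Nat.mod_eq_of_lt hx, Nat.mod_eq_of_lt hy] at h'
      exact hxy h'
    have hdvd : ∀ u w, u % s = w % s → w < u → u < q → ∃ j, (1 ≤ j ∧ j ≤ (q - 1) / s) ∧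
        u - w = s * j := by
      intro u w h1 h2 h3
      obtain ⟨j, hj⟩ := (Nat.modEq_iff_dvd' h2.le).1 (show w ≡ u [MOD s] from h1.symm)
      rcases Nat.eq_zero_or_pos s with rfl | hs
      · omega
      · refine ⟨j, ⟨Nat.pos_of_ne_zero (by rintro rfl; omega), ?_⟩, hj⟩
        rw [Nat.le_div_iff_mul_le hs, mul_comm]
        omega
    rw [hmod, Finset.mem_union, Finset.mem_image, Finset.mem_image]
    rcases lt_or_gt_of_ne hne with h | h
    · right
      obtain ⟨j, hj, he⟩ := hdvd _ _ hcol.symm h hw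
      refine ⟨j, Finset.mem_Icc.2 hj, ?_⟩
      rw [Nat.mod_eq_of_lt (by omega)]
      omega
    · left
      obtain ⟨j, hj, he⟩ := hdvd _ _ hcol h hu
      refine ⟨j, Finset.mem_Icc.2 hj, ?_⟩
      rw [show a * x % q + q - a * y % q = a * x % q - a * y % q + q by omega,
        Nat.add_mod_right, Nat.mod_eq_of_lt (by omega), he]
  refine (Finset.card_le_card hsub).trans ((Finset.card_union_le _ _).trans ?_)
  have h1 := Finset.card_image_le (s := Finset.Icc 1 ((q - 1) / s)) (f := fun j => s * j)
  have h2 := Finset.card_image_le (s := Finset.Icc 1 ((q - 1) / s)) (f := fun j => q - s * j)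
  rw [Nat.card_Icc] at h1 h2
  omega

/-- Some multiplier has no more collisions than the average. -/
theorem exists_multiplier {q : ℕ} (hq : q.Prime) (s : ℕ) {S : Finset ℕ} (hS : ∀ x ∈ S, x < q) :
    ∃ a < q, (S.offDiag.filter fun z => a * z.1 % q % s = a * z.2 % q % s).card * s ≤
      2 * S.offDiag.card := by
  classical
  have hq1 := hq.one_lt
  have hsum : ∑ a ∈ Finset.Ico 1 q,
      (S.offDiag.filter fun z => a * z.1 % q % s = a * z.2 % q % s).card * s ≤
      ∑ a ∈ Finset.Ico 1 q, 2 * S.offDiag.card := by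
    rw [← Finset.sum_mul, Finset.sum_const, Nat.card_Ico, smul_eq_mul]
    simp only [Finset.card_filter]
    rw [Finset.sum_comm]
    have h : ∀ z ∈ S.offDiag, ∑ a ∈ Finset.Ico 1 q,
        (if a * z.1 % q % s = a * z.2 % q % s then 1 else 0) ≤ 2 * ((q - 1) / s) := by
      intro z hz
      rw [Finset.mem_offDiag] at hz
      rw [← Finset.card_filter]
      exact card_collisions_le hq (hS _ hz.1) (hS _ hz.2.1) hz.2.2
    calc (∑ z ∈ S.offDiag, ∑ a ∈ Finset.Ico 1 q,
          (if a * z.1 % q % s = a * z.2 % q % s then 1 else 0)) * s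
        ≤ (S.offDiag.card * (2 * ((q - 1) / s))) * s :=
          Nat.mul_le_mul_right _ ((Finset.sum_le_card_nsmul _ _ _ h).trans (by simp))
      _ = 2 * S.offDiag.card * ((q - 1) / s * s) := by ring
      _ ≤ 2 * S.offDiag.card * (q - 1) := Nat.mul_le_mul_left _ (Nat.div_mul_le_self _ _)
      _ = (q - 1) * (2 * S.offDiag.card) := mul_comm _ _
  obtain ⟨a, ha, h⟩ := Finset.exists_le_of_sum_le (Finset.nonempty_Ico.2 hq1) hsum
  exact ⟨a, (Finset.mem_Ico.1 ha).2, h⟩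

/-- The address at which a two-level hash table stores the value of the key `x`, relative to the
start of its cells: the first level selects the bucket `b`, which has the multiplier `A b` and
occupies `B b` cells from the offset `O b` on. -/
def hashCell (q a s : ℕ) (A B O : ℕ → ℕ) (x : ℕ) : ℕ :=
  O (a * x % q % s) + A (a * x % q % s) * x % q % B (a * x % q % s)

/-- Perfect hashing in linear space. The first level has few collisions, so the squares of the
sizes of the buckets have a linear sum; a bucket whose number of cells exceeds twice the number of
pairs in it has a multiplier without collisions. Cells without a key hold the value `d`. -/
theorem exists_perfectHash {q : ℕ} (hq : q.Prime) (S : Finset ℕ) (hS : ∀ x ∈ S, x < q)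
    (f : ℕ → ℕ) (d : ℕ) :
    ∃ (a s : ℕ) (A B O : ℕ → ℕ) (tab : List ℕ),
      a < q ∧ 0 < s ∧ s ≤ S.card + 1 ∧ (∀ b < s, A b < q ∧ 0 < B b ∧ O b + B b ≤ tab.length) ∧
      tab.length ≤ 5 * S.card + 1 ∧ (∀ v ∈ tab, v = d ∨ ∃ x ∈ S, v = f x) ∧
      ∀ x ∈ S, tab[hashCell q a s A B O x]? = some (f x) := by
  classical
  obtain ⟨a, haq, ha⟩ := exists_multiplier hq (S.card + 1) hS
  obtain ⟨s, hs⟩ : ∃ s, s = S.card + 1 := ⟨_, rfl⟩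
  rw [← hs] at ha
  set bucket : ℕ → Finset ℕ := fun b => S.filter fun x => a * x % q % s = b with hbucket
  set B : ℕ → ℕ := fun b => 2 * (bucket b).offDiag.card + 1 with hB
  have hsecond : ∀ b, ∃ c < q, ∀ x ∈ bucket b, ∀ y ∈ bucket b,
      c * x % q % B b = c * y % q % B b → x = y := by
    intro b
    obtain ⟨c, hcq, hc⟩ := exists_multiplier hq (B b) (S := bucket b)
      fun x hx => hS x (Finset.mem_filter.1 hx).1
    refine ⟨c, hcq, fun x hx y hy hxy => ?_⟩
    by_contra hne
    have hpos : 1 ≤ ((bucket b).offDiag.filter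
        fun z => c * z.1 % q % B b = c * z.2 % q % B b).card :=
      Finset.card_pos.2 ⟨(x, y), Finset.mem_filter.2 ⟨Finset.mem_offDiag.2 ⟨hx, hy, hne⟩, hxy⟩⟩
    have := (Nat.mul_le_mul_right (B b) hpos).trans hc
    simp only [hB] at this
    omega
  choose A hAq hA using hsecond
  set cell : ℕ → ℕ → ℕ := fun b j =>
    if h : ∃ x ∈ bucket b, A b * x % q % B b = j then f h.choose else d with hcell
  obtain ⟨O, hO, -, hlay⟩ := exists_layout B (List.range s)
  obtain ⟨htab, hget⟩ := hlay (fun b => (List.range (B b)).map (cell b)) (by simp)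
  refine ⟨a, s, A, B, O, (List.range s).flatMap fun b => (List.range (B b)).map (cell b), haq,
    by omega, by omega, fun b hb => ⟨hAq b, by simp [hB], ?_⟩, ?_, ?_, ?_⟩
  · rw [htab]
    exact hO b (List.mem_range.2 hb)
  · rw [htab]
    have hpairs : ∑ b ∈ Finset.range s, (bucket b).offDiag.card ≤
        (S.offDiag.filter fun z => a * z.1 % q % s = a * z.2 % q % s).card := by
      rw [← Finset.card_biUnion]
      · refine Finset.card_le_card fun z hz => ?_
        obtain ⟨b, -, hz⟩ := Finset.mem_biUnion.1 hz
        simp only [hbucket, Finset.mem_offDiag, Finset.mem_filter] at hz ⊢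
        exact ⟨⟨hz.1.1, hz.2.1.1, hz.2.2⟩, hz.1.2.trans hz.2.1.2.symm⟩
      · intro b _ c _ hbc
        rw [Function.onFun, Finset.disjoint_left]
        intro z hz hz'
        simp only [hbucket, Finset.mem_offDiag, Finset.mem_filter] at hz hz'
        exact hbc (hz.1.2.symm.trans hz'.1.2)
    have hcount : (S.offDiag.filter fun z => a * z.1 % q % s = a * z.2 % q % s).card
        ≤ 2 * S.card := by
      have h1 : S.offDiag.card ≤ S.card * S.card := by rw [Finset.offDiag_card]; omega
      have h2 : (S.offDiag.filter fun z => a * z.1 % q % s = a * z.2 % q % s).card * s ≤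
          2 * S.card * s := by
        refine ha.trans ?_
        rw [hs]
        nlinarith
      exact Nat.le_of_mul_le_mul_right h2 (by omega)
    have h3 : ((List.range s).map B).sum =
        2 * ∑ b ∈ Finset.range s, (bucket b).offDiag.card + s := by
      change ∑ b ∈ Finset.range s, B b = _
      simp [hB, Finset.sum_add_distrib, Finset.mul_sum]
    omega
  · intro v hv
    simp only [List.mem_flatMap, List.mem_map, List.mem_range] at hv
    obtain ⟨b, -, j, -, rfl⟩ := hv
    simp only [hcell]
    split_ifs with h
    · exact Or.inr ⟨_, (Finset.mem_filter.1 h.choose_spec.1).1, rfl⟩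
    · exact Or.inl rfl
  · intro x hx
    have hb : a * x % q % s < s := Nat.mod_lt _ (by omega)
    have hj : A (a * x % q % s) * x % q % B (a * x % q % s) < B (a * x % q % s) :=
      Nat.mod_lt _ (by simp [hB])
    have hxb : x ∈ bucket (a * x % q % s) := Finset.mem_filter.2 ⟨hx, rfl⟩
    rw [hashCell, hget _ (List.mem_range.2 hb) _ hj, List.getElem?_map, List.getElem?_range hj,
      Option.map_some]
    have h : ∃ y ∈ bucket (a * x % q % s), A (a * x % q % s) * y % q % B (a * x % q % s) =
      A (a * x % q % s) * x % q % B (a * x % q % s) := ⟨x, hxb, rfl⟩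
    simp only [hcell]
    rw [dif_pos h, hA _ _ h.choose_spec.1 _ hxb h.choose_spec.2]

/-! ### Reasoning about programs -/

section Machine

variable {σ : ℕ}

/-- Overwrite the register `d` without reduction to a word. -/
def State.set (st : State) (d x : ℕ) : State := ⟨Function.update st.reg d x, st.out⟩

@[simp] theorem State.reg_set (st : State) (d x e : ℕ) :
    (st.set d x).reg e = if e = d then x else st.reg e := by
  simp [State.set, Function.update_apply]

@[simp] theorem State.out_set (st : State) (d x : ℕ) : (st.set d x).out = st.out := rfl

theorem State.write_eq_set {W : ℕ} (st : State) (d : ℕ) {x : ℕ} (hx : x < W) :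
    st.write W d x = st.set d x := by
  rw [State.write, Nat.mod_eq_of_lt hx, State.set]

/-- Started in `st`, the program `c` stops within `b` steps in a state that satisfies `Q`. -/
def Run (W : ℕ) (M : List ℕ) (P : List (Fin σ)) (c : Cmd) (st : State) (b : ℕ)
    (Q : State → Prop) : Prop :=
  ∃ t st', t ≤ b ∧ Exec W M P c st t st' ∧ Q st'

/-- An instruction without effect on the registers that matter; register `31` is scratch. -/
def skip : Cmd := .const 31 0

/-- Commands executed one after the other. -/
def block (l : List Cmd) : Cmd := l.foldr Cmd.seq skip

variable {W : ℕ} {M : List ℕ} {P : List (Fin σ)} {c c₁ c₂ : Cmd} {cs : List Cmd} {st : State}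
  {b b₁ b₂ : ℕ} {Q R : State → Prop}

theorem Run.mono (h : Run W M P c st b₁ R) (hb : b₁ ≤ b) (hQ : ∀ st', R st' → Q st') :
    Run W M P c st b Q := by
  obtain ⟨t, st', ht, he, hR⟩ := h
  exact ⟨t, st', ht.trans hb, he, hQ st' hR⟩

theorem Run.const {d k : ℕ} (hk : k < W) (h : Q (st.set d k)) :
    Run W M P (.const d k) st 1 Q :=
  ⟨1, _, le_rfl, .const d k st, by rwa [State.write_eq_set st d hk]⟩

theorem Run.skip (hW : 0 < W) (h : Q (st.set 31 0)) : Run W M P skip st 1 Q := Run.const hW h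

theorem Run.block_nil (hW : 0 < W) (h : Q (st.set 31 0)) : Run W M P (block []) st 1 Q :=
  Run.const hW h

theorem Run.block_cons (h₁ : Run W M P c st b₁ R)
    (h₂ : ∀ st', R st' → Run W M P (block cs) st' b₂ Q) :
    Run W M P (block (c :: cs)) st (b₂ + b₁) Q := by
  obtain ⟨t, st', ht, he, hR⟩ := h₁
  obtain ⟨t', st'', ht', he', hQ⟩ := h₂ st' hR
  exact ⟨t + t', st'', by omega, .seq he he', hQ⟩

theorem Run.block_const {d k : ℕ} (hk : k < W) (h : Run W M P (block cs) (st.set d k) b Q) :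
    Run W M P (block (.const d k :: cs)) st (b + 1) Q :=
  Run.block_cons (R := fun st' => st' = st.set d k) (Run.const hk rfl) fun _ h' => h' ▸ h

theorem Run.block_arith {o : Op} {d a a' : ℕ} (x : ℕ) (hx : o.eval (st.reg a) (st.reg a') = x)
    (hxW : x < W) (h : Run W M P (block cs) (st.set d x) b Q) :
    Run W M P (block (.arith o d a a' :: cs)) st (b + 1) Q :=
  Run.block_cons (R := fun st' => st' = st.set d x)
    ⟨1, _, le_rfl, .arith o d a a' st, by rw [hx, State.write_eq_set st d hxW]⟩ fun _ h' => h' ▸ h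

theorem Run.block_load {d a : ℕ} (x : ℕ) (hx : M.getD (st.reg a) 0 = x)
    (hxW : x < W) (h : Run W M P (block cs) (st.set d x) b Q) :
    Run W M P (block (.load d a :: cs)) st (b + 1) Q :=
  Run.block_cons (R := fun st' => st' = st.set d x)
    ⟨1, _, le_rfl, .load d a st, by rw [hx, State.write_eq_set st d hxW]⟩ fun _ h' => h' ▸ h

theorem Run.block_letter {d a : ℕ} (x : ℕ) (hx : letterCode P (st.reg a) = x)
    (hxW : x < W) (h : Run W M P (block cs) (st.set d x) b Q) :
    Run W M P (block (.letter d a :: cs)) st (b + 1) Q :=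
  Run.block_cons (R := fun st' => st' = st.set d x)
    ⟨1, _, le_rfl, .letter d a st, by rw [hx, State.write_eq_set st d hxW]⟩ fun _ h' => h' ▸ h

theorem Run.block_output {a : ℕ} (x : ℕ) (hx : st.reg a = x)
    (h : Run W M P (block cs) ⟨st.reg, st.out ++ [x]⟩ b Q) :
    Run W M P (block (.output a :: cs)) st (b + 1) Q :=
  Run.block_cons (R := fun st' => st' = ⟨st.reg, st.out ++ [x]⟩)
    ⟨1, _, le_rfl, .output a st, by rw [hx]⟩ fun _ h' => h' ▸ h

theorem Run.cond {a a' : ℕ} (h₁ : st.reg a < st.reg a' → Run W M P c₁ st b Q)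
    (h₂ : ¬ st.reg a < st.reg a' → Run W M P c₂ st b Q) :
    Run W M P (.cond a a' c₁ c₂) st (b + 1) Q := by
  by_cases h : st.reg a < st.reg a'
  · obtain ⟨t, st', ht, he, hQ⟩ := h₁ h
    exact ⟨t + 1, st', by omega, .cond_true h he, hQ⟩
  · obtain ⟨t, st', ht, he, hQ⟩ := h₂ h
    exact ⟨t + 1, st', by omega, .cond_false h he, hQ⟩

/-- The rule for loops. The index of the invariant is the number of iterations still to come. -/
theorem Run.loop {a a' : ℕ} {Inv : ℕ → State → Prop}
    (hstep : ∀ k st, Inv (k + 1) st → st.reg a < st.reg a' ∧ Run W M P c st b (Inv k))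
    (hexit : ∀ st, Inv 0 st → ¬ st.reg a < st.reg a') (k : ℕ) (h : Inv k st) :
    Run W M P (.loop a a' c) st (k * (b + 1) + 1) (Inv 0) := by
  induction k generalizing st with
  | zero => exact ⟨1, st, by omega, Exec.loop_stop (hexit st h), h⟩
  | succ k ih =>
    obtain ⟨hlt, t, st', ht, he, hI⟩ := hstep k st h
    obtain ⟨t', st'', ht', he', hI'⟩ := ih hI
    refine ⟨t + t' + 1, st'', ?_, .loop_step hlt he he', hI'⟩
    rw [add_mul]; omega

theorem letterCode_of_lt {i : ℕ} (hi : i < P.length) : letterCode P i = (P[i] : ℕ) + 1 := by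
  simp [letterCode, hi]

theorem letterCode_pos_iff {i : ℕ} : 0 < letterCode P i ↔ i < P.length := by
  by_cases hi : i < P.length
  · simp [letterCode_of_lt hi, hi]
  · simp [letterCode, hi]

theorem letterCode_le (i : ℕ) : letterCode P i ≤ σ := by
  by_cases hi : i < P.length
  · rw [letterCode_of_lt hi]
    exact P[i].isLt
  · simp [letterCode, hi]

end Machine

/-! ### The query program -/

section Query

variable {σ : ℕ}

/-- Load the constants of the data structure from the first eleven words of the array. -/
def readHeader : List Cmd :=
  [.const 1 1,
    .const 31 0, .load 2 31, .const 31 1, .load 3 31, .const 31 2, .load 13 31,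
    .const 31 3, .load 4 31, .const 31 4, .load 5 31, .const 31 5, .load 6 31,
    .const 31 6, .load 7 31, .const 31 7, .load 8 31, .const 31 8, .load 9 31,
    .const 31 9, .load 10 31, .const 31 10, .load 11 31]

/-- Compute the length of the pattern in register `12`, but stop as soon as it is larger than the
length of the text: a longer pattern does not occur, and its length need not be a word of the
machine. -/
def measure : List Cmd :=
  [.const 12 0, .letter 16 12,
    .loop 0 16 (block [.arith .add 12 12 1, .letter 16 12, .cond 2 12 (.const 16 0) skip])]

/-- Go from the node in register `13`, whose depth is in register `14`, to the child for the next
letter of the pattern, whose address the hash table holds. -/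
def descend : Cmd := block
  [.letter 16 14, .arith .mul 17 13 4, .arith .add 17 17 16,
    .arith .mul 18 6 17, .arith .mod 18 18 5, .arith .mod 18 18 7,
    .arith .add 19 8 18, .load 19 19, .arith .mul 19 19 17, .arith .mod 19 19 5,
    .arith .add 20 9 18, .load 20 20, .arith .mod 19 19 20,
    .arith .add 20 10 18, .load 20 20, .arith .add 19 20 19,
    .arith .add 19 11 19, .load 13 19, .load 14 13]

/-- Descend until the depth is at least the length of the pattern. Letters inside an edge are not
inspected, and so the node reached is the locus of the pattern if the pattern occurs at all. -/
def walk : List Cmd :=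
  [.const 15 0, .load 14 13,
    .loop 15 12 (block [.cond 14 12 descend skip, .arith .add 15 15 1])]

/-- Compare the pattern with an occurrence of the string of the node; register `21` becomes `1` if
they agree and `0` otherwise. -/
def verify : List Cmd :=
  [.cond 14 12 (.const 21 0) (.const 21 1), .arith .add 22 13 1, .load 22 22, .arith .add 22 22 3,
    .const 15 0,
    .loop 15 12 (block [.arith .add 16 22 15, .load 16 16, .letter 17 15, .arith .sub 17 17 1,
      .cond 16 17 (.const 21 0) (.cond 17 16 (.const 21 0) skip), .arith .add 15 15 1])]

/-- Find the slot of the period path of the pattern in the record of its locus and output the list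
from the stored pointer on. -/
def report : Cmd := block
  [.const 23 3, .arith .add 15 13 23, .arith .add 16 15 1, .load 16 16,
    .loop 16 12 (block [.arith .add 15 15 23, .arith .add 16 15 1, .load 16 16]),
    .load 17 15, .arith .add 18 15 1, .arith .add 18 18 1, .load 18 18,
    .loop 17 18 (block [.load 19 17, .output 19, .arith .add 17 17 1,
      .load 19 17, .output 19, .arith .add 17 17 1])]

/-- The query program. -/
def query : Cmd := block (readHeader ++ measure ++
  [.cond 2 12 skip (block (walk ++ verify ++ [.cond 0 21 report skip]))])

/-- What the query program needs to find in the array in addition to the data structure proper. -/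
structure QueryWords {T : List (Fin σ)} {M : List ℕ} (D : PeriodIndex T M) where
  /-- the constants of the hash table and the addresses of its four parts -/
  (K q a s addrA addrB addrO addrTab : ℕ)
  (A B O : ℕ → ℕ)
  header : M.take 11 =
    [T.length, D.text, D.node [], K, q, a, s, addrA, addrB, addrO, addrTab]
  /-- a word behind the text that is not a letter -/
  text_end : M[D.text + T.length]? = some σ
  q_pos : 0 < q
  s_pos : 0 < s
  A_eq : ∀ b < s, M[addrA + b]? = some (A b)
  B_eq : ∀ b < s, M[addrB + b]? = some (B b)
  B_pos : ∀ b < s, 0 < B b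
  O_eq : ∀ b < s, M[addrO + b]? = some (O b)
  /-- the node that the hash table gives for a node and a letter -/
  next : List (Option (Fin σ)) → ℕ → List (Option (Fin σ))
  next_isNode : ∀ u c, IsNode T u → IsNode T (next u c)
  next_eq : ∀ u (c : Fin σ) v, IsNode T u → IsStringLocus T (u ++ [some c]) v →
    next u (c + 1) = v
  tab_eq : ∀ u c, IsNode T u →
    M[addrTab + hashCell q a s A B O (D.node u * K + c)]? = some (D.node (next u c))
  /-- the lengths at which the period paths that meet the edge above a node end, in increasing
  order -/
  ends : List (Option (Fin σ)) → List ℕ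
  ends_sorted : ∀ v, (ends v).Pairwise (· < ·)
  mem_ends : ∀ v l, IsNode T v → (l ∈ ends v ↔ ∃ p, IsPathEnd T v p l)
  /-- a slot consists of the pointer, the length at which the path ends, and the end of the list -/
  ends_eq : ∀ v j l, IsNode T v → (ends v)[j]? = some l → M[D.node v + 3 + 3 * j + 1]? = some l
  ptr_eq : ∀ v j p l, IsPathEnd T v p l → IsNode T v → (ends v)[j]? = some l →
    M[D.node v + 3 + 3 * j]? =
      some (D.list p + 2 * (D.seqs p).countP fun y => seqLength y < l)
  last_eq : ∀ v j p l, IsPathEnd T v p l → IsNode T v → (ends v)[j]? = some l →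
    M[D.node v + 3 + 3 * j + 2]? = some (D.list p + 2 * (D.seqs p).length)

end Query

/-! ### Correctness of the query program -/

section QueryCorrect

variable {σ : ℕ} {T : List (Fin σ)} {M : List ℕ} {D : PeriodIndex T M} {P : List (Fin σ)}

theorem getD_of_getElem? {i x : ℕ} (h : M[i]? = some x) : M.getD i 0 = x := by
  rw [List.getD_eq_getElem?_getD, h, Option.getD_some]

/-- The registers that hold the constants of the data structure. -/
structure QueryWords.Loaded (X : QueryWords D) (st : State) : Prop where
  r0 : st.reg 0 = 0
  r1 : st.reg 1 = 1
  r2 : st.reg 2 = T.length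
  r3 : st.reg 3 = D.text
  r4 : st.reg 4 = X.K
  r5 : st.reg 5 = X.q
  r6 : st.reg 6 = X.a
  r7 : st.reg 7 = X.s
  r8 : st.reg 8 = X.addrA
  r9 : st.reg 9 = X.addrB
  r10 : st.reg 10 = X.addrO
  r11 : st.reg 11 = X.addrTab

theorem QueryWords.Loaded.set {X : QueryWords D} {st : State} (h : X.Loaded st) {d : ℕ}
    (hd : 12 ≤ d) (x : ℕ) : X.Loaded (st.set d x) := by
  constructor <;> rw [State.reg_set, if_neg (by omega)]
  exacts [h.r0, h.r1, h.r2, h.r3, h.r4, h.r5, h.r6, h.r7, h.r8, h.r9, h.r10, h.r11]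

/-- A bound `N` for the words of the array, its length and the alphabet, such that products of three
such numbers are words of the machine. -/
structure Fits (σ : ℕ) (M : List ℕ) (N W : ℕ) : Prop where
  word_le : ∀ w ∈ M, w ≤ N
  length_le : M.length ≤ N
  sigma_le : σ ≤ N
  four_le : 4 ≤ N
  cube_le : (N + 1) ^ 3 ≤ W

variable {N W : ℕ}

theorem Fits.getD_le (F : Fits σ M N W) (i : ℕ) : M.getD i 0 ≤ N := by
  rw [List.getD_eq_getElem?_getD]
  rcases h : M[i]? with _ | x
  · simp
  · exact F.word_le x (List.mem_of_getElem? h)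

theorem Fits.le_of_getElem? (F : Fits σ M N W) {i x : ℕ} (h : M[i]? = some x) : x ≤ N :=
  F.word_le x (List.mem_of_getElem? h)

theorem Fits.lt_of_getElem? (F : Fits σ M N W) {i x : ℕ} (h : M[i]? = some x) : i < N :=
  (List.getElem?_eq_some_iff.1 h).1.trans_le F.length_le

theorem Fits.four_mul_lt (F : Fits σ M N W) {x : ℕ} (h : x ≤ 4 * N) : x < W := by
  have h1 := F.cube_le
  have h2 := F.four_le
  nlinarith [Nat.mul_le_mul h2 (le_refl N), Nat.zero_le (N * N * N)]

theorem Fits.product_lt (F : Fits σ M N W) {x : ℕ} (h : x ≤ N * (N * N + N)) : x < W := by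
  have h1 := F.cube_le
  nlinarith [Nat.zero_le (N * N), Nat.zero_le N]

theorem QueryWords.header_eq (X : QueryWords D) {j x : ℕ}
    (h : [T.length, D.text, D.node [], X.K, X.q, X.a, X.s, X.addrA, X.addrB, X.addrO,
      X.addrTab][j]? = some x) : M[j]? = some x := by
  rw [← X.header] at h
  have hj := (List.getElem?_eq_some_iff.1 h).1
  rw [List.length_take] at hj
  rwa [List.getElem?_take_of_lt (by omega)] at h

theorem run_readHeader (X : QueryWords D) (F : Fits σ M N W) {cs : List Cmd} {b : ℕ}
    {Q : State → Prop}
    (h : ∀ st, X.Loaded st → st.reg 13 = D.node [] → st.out = [] →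
      Run W M P (block cs) st b Q) :
    Run W M P (block (readHeader ++ cs)) State.init (b + 23) Q := by
  have hc : ∀ k, k ≤ 11 → k < W := fun k hk => F.four_mul_lt (by have := F.four_le; omega)
  have hx : ∀ {j x}, [T.length, D.text, D.node [], X.K, X.q, X.a, X.s, X.addrA, X.addrB, X.addrO,
      X.addrTab][j]? = some x → M.getD j 0 = x ∧ x < W := fun {j x} hj =>
    ⟨getD_of_getElem? (X.header_eq hj),
      F.four_mul_lt (by have := F.le_of_getElem? (X.header_eq hj); omega)⟩
  have load : ∀ {j x d st b cs}, [T.length, D.text, D.node [], X.K, X.q, X.a, X.s, X.addrA,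
      X.addrB, X.addrO, X.addrTab][j]? = some x → j ≤ 10 →
      Run W M P (block cs) ((st.set 31 j).set d x) b Q →
      Run W M P (block (.const 31 j :: .load d 31 :: cs)) st (b + 1 + 1) Q := by
    intro j x d st b cs hj hj' hrun
    refine Run.block_const (hc _ (by omega)) (Run.block_load x ?_ (hx hj).2 hrun)
    simpa using (hx hj).1
  refine Run.block_const (hc _ (by omega)) ?_
  refine load (x := T.length) rfl (by omega) ?_
  refine load (x := D.text) rfl (by omega) ?_
  refine load (x := D.node []) rfl (by omega) ?_
  refine load (x := X.K) rfl (by omega) ?_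
  refine load (x := X.q) rfl (by omega) ?_
  refine load (x := X.a) rfl (by omega) ?_
  refine load (x := X.s) rfl (by omega) ?_
  refine load (x := X.addrA) rfl (by omega) ?_
  refine load (x := X.addrB) rfl (by omega) ?_
  refine load (x := X.addrO) rfl (by omega) ?_
  refine load (x := X.addrTab) rfl (by omega) ?_
  refine h _ ?_ (by simp) (by simp [State.init])
  constructor <;> simp [State.init]

theorem run_measure (X : QueryWords D) (F : Fits σ M N W) {cs : List Cmd} {b : ℕ}
    {Q : State → Prop} {st : State} {u : ℕ} (hst : X.Loaded st) (h13 : st.reg 13 = u)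
    (hout : st.out = [])
    (h : ∀ st, X.Loaded st → st.reg 13 = u → st.out = [] →
      st.reg 12 = min P.length (T.length + 1) → Run W M P (block cs) st b Q) :
    Run W M P (block (measure ++ cs)) st (b + (P.length * 6 + 1) + 2) Q := by
  have hn : T.length ≤ N := F.le_of_getElem? (X.header_eq (j := 0) rfl)
  have hN := F.four_le
  have hletter : ∀ i, letterCode P i < W := fun i =>
    F.four_mul_lt (by have := letterCode_le (P := P) i; have := F.sigma_le; omega)
  set μ := min P.length (T.length + 1) with hμ
  refine Run.block_const (F.four_mul_lt (by omega)) ?_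
  refine Run.block_letter (letterCode P 0) (by simp) (hletter 0) ?_
  refine Run.block_cons (b₁ := P.length * 6 + 1)
    (R := fun st => X.Loaded st ∧ st.reg 13 = u ∧ st.out = [] ∧ st.reg 12 = μ) ?_
    fun st' hst' => h st' hst'.1 hst'.2.1 hst'.2.2.1 hst'.2.2.2
  refine Run.mono (Run.loop (b := 5) (Inv := fun k st => X.Loaded st ∧ st.reg 13 = u ∧
    st.out = [] ∧ st.reg 12 + k = μ ∧ (0 < st.reg 16 ↔ 0 < k)) ?_ ?_ μ ?_) ?_ ?_
  · rintro k st ⟨hl, h13, hout, h12, h16⟩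
    refine ⟨by rw [hl.r0]; exact h16.2 (by omega), ?_⟩
    refine Run.block_arith (st.reg 12 + 1) (by simp [Op.eval, hl.r1]) (F.four_mul_lt (by omega)) ?_
    refine Run.block_letter (letterCode P (st.reg 12 + 1)) (by simp) (hletter _) ?_
    refine Run.mono (b₁ := 1 + (1 + 1)) (Run.block_cons (R := fun st' => X.Loaded st' ∧
      st'.reg 13 = u ∧ st'.out = [] ∧ st'.reg 12 + k = μ ∧ (0 < st'.reg 16 ↔ 0 < k)) (Run.cond
      (fun hc => Run.const (F.four_mul_lt (by omega)) ?_)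
      (fun hc => Run.skip (F.four_mul_lt (by omega)) ?_)) (fun st' hst' => ?_)) (by omega)
      (fun st' hst' => hst')
    · simp only [State.reg_set, hl.r2] at hc
      refine ⟨((hl.set (by omega) _).set (by omega) _).set (by omega) _, by simpa using h13,
        by simpa using hout, by simp; omega, ?_⟩
      simp at hc ⊢
      omega
    · simp only [State.reg_set, hl.r2] at hc
      refine ⟨((hl.set (by omega) _).set (by omega) _).set (by omega) _, by simpa using h13,
        by simpa using hout, by simp; omega, ?_⟩
      simp at hc
      simp only [State.reg_set]
      norm_num
      rw [letterCode_pos_iff]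
      omega
    · refine Run.block_nil (F.four_mul_lt (by omega)) ⟨hst'.1.set (by omega) _, ?_⟩
      simpa using hst'.2
  · rintro st ⟨hl, -, -, -, h16⟩
    rw [hl.r0]
    omega
  · refine ⟨(hst.set (by omega) _).set (by omega) _, by simpa using h13, by simpa using hout,
      by simp, ?_⟩
    simp only [State.reg_set]
    norm_num
    rw [letterCode_pos_iff]
    omega
  · have : μ ≤ P.length := min_le_left _ _
    omega
  · rintro st ⟨hl, h13, hout, h12, -⟩
    exact ⟨hl, h13, hout, by omega⟩

/-- The state during the descent: the program is at the node `u`. -/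
structure QueryWords.At (X : QueryWords D) (m : ℕ) (u : List (Option (Fin σ))) (st : State) :
    Prop where
  loaded : X.Loaded st
  out : st.out = []
  r12 : st.reg 12 = m
  r13 : st.reg 13 = D.node u
  r14 : st.reg 14 = u.length

/-- The products stay below `(N + 1) ^ 3`, and so no arithmetic operation overflows. -/
theorem run_descend (X : QueryWords D) (F : Fits σ M N W) {m : ℕ} {u : List (Option (Fin σ))}
    (hu : IsNode T u) {st : State} (hst : X.At m u st) {i : ℕ} (h15 : st.reg 15 = i) :
    Run W M P descend st 20
      (fun st' => X.At m (X.next u (letterCode P u.length)) st' ∧ st'.reg 15 = i) := by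
  obtain ⟨hl, hout, h12, h13, h14⟩ := hst
  have hN := F.four_le
  obtain ⟨c, hc⟩ : ∃ c, c = letterCode P u.length := ⟨_, rfl⟩
  have hcN : c ≤ N := hc ▸ (letterCode_le _).trans F.sigma_le
  have hnode : D.node u ≤ N := by
    have := F.lt_of_getElem? (D.depth_eq u hu); omega
  have hK : X.K ≤ N := F.le_of_getElem? (X.header_eq (j := 3) rfl)
  have hq : X.q ≤ N := F.le_of_getElem? (X.header_eq (j := 4) rfl)
  have ha : X.a ≤ N := F.le_of_getElem? (X.header_eq (j := 5) rfl)
  obtain ⟨x, hx⟩ : ∃ x, x = D.node u * X.K + c := ⟨_, rfl⟩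
  have hxN : x ≤ N * N + N := hx ▸ add_le_add (Nat.mul_le_mul hnode hK) hcN
  have hprod : ∀ y, y ≤ N → y * x < W := fun y hy => F.product_lt (Nat.mul_le_mul hy hxN)
  have hsmall : ∀ {y}, y ≤ 4 * N → y < W := fun hy => F.four_mul_lt hy
  obtain ⟨b, hb⟩ : ∃ b, b = X.a * x % X.q % X.s := ⟨_, rfl⟩
  have hbs : b < X.s := hb ▸ Nat.mod_lt _ X.s_pos
  have hA := X.A_eq b hbs
  have hB := X.B_eq b hbs
  have hO := X.O_eq b hbs
  have hAN := F.le_of_getElem? hA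
  have hBN := F.le_of_getElem? hB
  have hON := F.le_of_getElem? hO
  have hA' := F.lt_of_getElem? hA
  have hB' := F.lt_of_getElem? hB
  have hO' := F.lt_of_getElem? hO
  have hbN : b ≤ N := by omega
  have hmodq : ∀ y, y % X.q ≤ N := fun y => (Nat.mod_lt y X.q_pos).le.trans hq
  have hcell : X.O b + X.A b * x % X.q % X.B b =
      hashCell X.q X.a X.s X.A X.B X.O x := by rw [hashCell, hb]
  have htab := X.tab_eq u c hu
  rw [← hx] at htab
  have htabN := F.lt_of_getElem? htab
  have hnext := X.next_isNode u c hu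
  have hdepth := D.depth_eq _ hnext
  have hxlt : x < W := F.product_lt (hxN.trans (Nat.le_mul_of_pos_left _ (by omega)))
  have hxlt' : D.node u * X.K < W := by omega
  rw [descend]
  refine Run.block_letter c (by rw [h14, hc]) (hsmall (by omega)) ?_
  refine Run.block_arith (D.node u * X.K) (by simp [Op.eval, h13, hl.r4]) hxlt' ?_
  refine Run.block_arith x (by simp [Op.eval, hx]) hxlt ?_
  refine Run.block_arith (X.a * x) (by simp [Op.eval, hl.r6]) (hprod _ ha) ?_
  refine Run.block_arith (X.a * x % X.q) (by simp [Op.eval, hl.r5])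
    (hsmall (by have := hmodq (X.a * x); omega)) ?_
  refine Run.block_arith b (by simp [Op.eval, hl.r7, hb]) (hsmall (by omega)) ?_
  refine Run.block_arith (X.addrA + b) (by simp [Op.eval, hl.r8]) (hsmall (by omega)) ?_
  refine Run.block_load (X.A b) (by simpa using getD_of_getElem? hA) (hsmall (by omega)) ?_
  refine Run.block_arith (X.A b * x) (by simp [Op.eval]) (hprod _ hAN) ?_
  refine Run.block_arith (X.A b * x % X.q) (by simp [Op.eval, hl.r5])
    (hsmall (by have := hmodq (X.A b * x); omega)) ?_
  refine Run.block_arith (X.addrB + b) (by simp [Op.eval, hl.r9]) (hsmall (by omega)) ?_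
  refine Run.block_load (X.B b) (by simpa using getD_of_getElem? hB) (hsmall (by omega)) ?_
  have hmodB : X.A b * x % X.q % X.B b ≤ N := (Nat.mod_lt _ (X.B_pos b hbs)).le.trans hBN
  refine Run.block_arith (X.A b * x % X.q % X.B b) (by simp [Op.eval]) (hsmall (by omega)) ?_
  refine Run.block_arith (X.addrO + b) (by simp [Op.eval, hl.r10]) (hsmall (by omega)) ?_
  refine Run.block_load (X.O b) (by simpa using getD_of_getElem? hO) (hsmall (by omega)) ?_
  refine Run.block_arith (hashCell X.q X.a X.s X.A X.B X.O x) (by simp [Op.eval, hcell])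
    (hsmall (by omega)) ?_
  refine Run.block_arith (X.addrTab + hashCell X.q X.a X.s X.A X.B X.O x)
    (by simp [Op.eval, hl.r11]) (hsmall (by omega)) ?_
  refine Run.block_load (D.node (X.next u c)) (by simpa using getD_of_getElem? htab)
    (hsmall (by have := F.le_of_getElem? htab; omega)) ?_
  refine Run.block_load (X.next u c).length (by simpa using getD_of_getElem? hdepth)
    (hsmall (by have := F.le_of_getElem? hdepth; omega)) ?_
  refine Run.block_nil (hsmall (by omega)) ⟨⟨?_, by simpa using hout, by simpa using h12,
    by simp [hc], by simp [hc]⟩, by simpa using h15⟩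
  repeat' refine QueryWords.Loaded.set ?_ (by omega) _
  exact hl

/-- If the pattern occurs, the descent ends at its locus; in any case it ends at a node. -/
theorem run_walk (X : QueryWords D) (F : Fits σ M N W) {cs : List Cmd} {b : ℕ}
    {Q : State → Prop} {st : State} (hst : X.Loaded st) (hout : st.out = [])
    (h12 : st.reg 12 = P.length) (h13 : st.reg 13 = D.node []) (hPT : P.length ≤ T.length)
    (h : ∀ u st, IsNode T u → (∀ L, IsLocus T P L → u = L) → X.At P.length u st →
      Run W M P (block cs) st b Q) :
    Run W M P (block (walk ++ cs)) st (b + (P.length * 24 + 1) + 2) Q := by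
  have hN := F.four_le
  have hn : T.length ≤ N := F.le_of_getElem? (X.header_eq (j := 0) rfl)
  refine Run.block_const (F.four_mul_lt (by omega)) ?_
  have hroot := D.depth_eq [] (isNode_nil T)
  refine Run.block_load 0 (by simpa [h13] using getD_of_getElem? hroot)
    (F.four_mul_lt (by omega)) ?_
  refine Run.block_cons (R := fun st => ∃ u, IsNode T u ∧ (∀ L, IsLocus T P L → u = L) ∧
    X.At P.length u st) ?_ fun st' ⟨u, h1, h2, h3⟩ => h u st' h1 h2 h3
  -- each iteration increases the depth by at least one until it reaches `|P|`
  refine Run.mono (Run.loop (b := 23) (Inv := fun k st => ∃ u, IsNode T u ∧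
    (∀ L, IsLocus T P L → u <+: L ∧ (P.length ≤ u.length + k)) ∧
    X.At P.length u st ∧ st.reg 15 + k = P.length) ?_ ?_ P.length ?_) le_rfl ?_
  · rintro k st ⟨u, hu, hL, hat, h15⟩
    refine ⟨by rw [hat.r12]; omega, ?_⟩
    refine Run.mono (Run.block_cons (R := fun st' => ∃ u, IsNode T u ∧
      (∀ L, IsLocus T P L → u <+: L ∧ (P.length ≤ u.length + k)) ∧
      X.At P.length u st' ∧ st'.reg 15 = st.reg 15) (b₂ := 1 + 1) (Run.cond (b := 20)
      (fun hc => Run.mono (run_descend X F hu hat rfl) le_rfl ?_)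
      (fun hc => Run.mono (Run.skip (Q := fun st' => st' = st.set 31 0)
        (F.four_mul_lt (by omega)) rfl) (by omega) ?_)) ?_) (by omega) fun st' hst' => hst'
    · rintro st' ⟨hat', h15'⟩
      refine ⟨_, X.next_isNode u _ hu, fun L hLoc => ?_, hat', h15'⟩
      obtain ⟨hpre, hle⟩ := hL L hLoc
      rw [hat.r14, hat.r12] at hc
      obtain ⟨v, hv, hvL, hlt⟩ := hLoc.step hpre (List.getElem?_eq_getElem hc)
      rw [letterCode_of_lt hc, X.next_eq u _ v hu hv]
      exact ⟨hvL, by omega⟩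
    · rintro st' rfl
      rw [hat.r14, hat.r12] at hc
      refine ⟨u, hu, fun L hLoc => ⟨(hL L hLoc).1, by omega⟩,
        ⟨hat.loaded.set (by omega) _, hat.out, ?_, ?_, ?_⟩, by simp⟩
      · simpa using hat.r12
      · simpa using hat.r13
      · simpa using hat.r14
    · rintro st' ⟨u', hu', hL', hat', h15'⟩
      refine Run.block_arith (st.reg 15 + 1) (by simp [Op.eval, hat'.loaded.r1, h15'])
        (F.four_mul_lt (by omega)) ?_
      refine Run.block_nil (F.four_mul_lt (by omega)) ⟨u', hu', hL',
        ⟨(hat'.loaded.set (by omega) _).set (by omega) _, hat'.out, ?_, ?_, ?_⟩, by simp; omega⟩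
      · simpa using hat'.r12
      · simpa using hat'.r13
      · simpa using hat'.r14
  · rintro st ⟨u, -, -, hat, h15⟩
    rw [hat.r12]
    omega
  · refine ⟨[], isNode_nil T, fun L _ => ⟨List.nil_prefix, by simp⟩,
      ⟨(hst.set (by omega) _).set (by omega) _, by simpa using hout, ?_, ?_, ?_⟩, by simp⟩
    · simpa using h12
    · simpa using h13
    · simp
  · rintro st ⟨u, hu, hL, hat, -⟩
    exact ⟨u, hu, fun L hLoc =>
      hLoc.eq_of_length_le hu (hL L hLoc).1 (by simpa using (hL L hLoc).2), hat⟩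

/-- The comparison with the text decides whether the pattern occurs. -/
theorem matches_iff (X : QueryWords D) (hP : P ≠ []) {u : List (Option (Fin σ))} {i₀ : ℕ}
    (hu : ∀ L, IsLocus T P L → u = L) (hi₀ : OccursAt u (marked T) i₀) :
    (P.length ≤ u.length ∧ ∀ i < P.length, M.getD (D.text + i₀ + i) 0 = letterCode P i - 1) ↔
      P <:+: T := by
  have hm := List.length_pos_iff.2 hP
  have hroom : P.length ≤ u.length → i₀ + P.length ≤ T.length + 1 := by
    intro h
    have := hi₀.length_le
    rw [List.length_drop, length_marked] at this
    omega
  constructor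
  · rintro ⟨hlen, hmatch⟩
    refine prefix_drop_infix (i := i₀) (prefix_of_getElem? fun i hi => ?_)
    have h := hmatch i hi
    have := hroom hlen
    rw [letterCode_of_lt hi, Nat.add_sub_cancel, add_assoc] at h
    rw [List.getElem?_drop, List.getElem?_eq_getElem hi]
    by_cases hin : i₀ + i < T.length
    · rw [List.getElem?_eq_getElem hin]
      rw [getD_of_getElem? (D.text_eq _ _ (List.getElem?_eq_getElem hin))] at h
      rw [Fin.ext h]
    · rw [show i₀ + i = T.length by omega, getD_of_getElem? X.text_end] at h
      exact absurd h (P[i].isLt.ne')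
  · intro hPT
    obtain ⟨L, hL⟩ := exists_isLocus hPT
    obtain rfl := hu L hL
    have hlen : P.length ≤ u.length := by simpa using hL.2.1.length_le
    refine ⟨hlen, fun i hi => ?_⟩
    have hmk : (marked T)[i₀ + i]? = some (some P[i]) := by
      rw [← List.getElem?_drop, getElem?_eq_of_prefix hi₀ (by omega),
        getElem?_eq_of_prefix hL.2.1 (by simpa using hi)]
      simp [hi]
    have hT : T[i₀ + i]? = some P[i] := by
      rw [marked] at hmk
      by_cases hin : i₀ + i < T.length
      · rw [List.getElem?_append_left (by simpa using hin)] at hmk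
        simpa using hmk
      · have := hroom hlen
        rw [List.getElem?_append_right (by simpa using hin), List.length_map,
          show i₀ + i - T.length = 0 by omega] at hmk
        simp at hmk
    rw [letterCode_of_lt hi, Nat.add_sub_cancel, add_assoc, getD_of_getElem? (D.text_eq _ _ hT)]

open Classical in
theorem run_verify (X : QueryWords D) (F : Fits σ M N W) {cs : List Cmd} {b : ℕ}
    {Q : State → Prop} {st : State} {u : List (Option (Fin σ))} (hu : IsNode T u)
    (huL : ∀ L, IsLocus T P L → u = L) (hP : P ≠ []) (hPT : P.length ≤ T.length)
    (hst : X.At P.length u st)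
    (h : ∀ st, X.At P.length u st → st.reg 21 = (if P <:+: T then 1 else 0) →
      Run W M P (block cs) st b Q) :
    Run W M P (block (verify ++ cs)) st (b + (P.length * 10 + 1) + 1 + 1 + 1 + 1 + 2) Q := by
  have hN := F.four_le
  have hn : T.length ≤ N := F.le_of_getElem? (X.header_eq (j := 0) rfl)
  have htext : D.text ≤ N := F.le_of_getElem? (X.header_eq (j := 1) rfl)
  obtain ⟨i₀, hlab, hi₀⟩ := D.label_eq u hu
  have hi₀N := F.le_of_getElem? hlab
  have hsmall : ∀ {y}, y ≤ 4 * N → y < W := fun hy => F.four_mul_lt hy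
  set ok : ℕ → Prop := fun j =>
    P.length ≤ u.length ∧ ∀ i < j, M.getD (D.text + i₀ + i) 0 = letterCode P i - 1 with hok
  have hok_succ : ∀ j, ok (j + 1) ↔
      ok j ∧ M.getD (D.text + i₀ + j) 0 = letterCode P j - 1 := by
    intro j
    simp only [hok, and_assoc]
    refine and_congr_right fun _ => ⟨fun h => ⟨fun i hi => h i (by omega), h j (by omega)⟩, ?_⟩
    rintro ⟨h1, h2⟩ i hi
    rcases Nat.lt_succ_iff_lt_or_eq.1 hi with hi | rfl
    exacts [h1 i hi, h2]
  have hok_all : ok P.length ↔ P <:+: T := matches_iff X hP huL hi₀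
  refine Run.block_cons (R := fun st' => X.At P.length u st' ∧
    st'.reg 21 = if ok 0 then 1 else 0) (b₁ := 2) (Run.cond (b := 1) (fun hc => ?_)
    (fun hc => ?_)) ?_
  · rw [hst.r14, hst.r12] at hc
    refine Run.const (hsmall (by omega)) ⟨⟨hst.loaded.set (by omega) _, hst.out, ?_, ?_, ?_⟩, ?_⟩
    · simpa using hst.r12
    · simpa using hst.r13
    · simpa using hst.r14
    · simp [hok, hc]
  · rw [hst.r14, hst.r12] at hc
    refine Run.const (hsmall (by omega)) ⟨⟨hst.loaded.set (by omega) _, hst.out, ?_, ?_, ?_⟩, ?_⟩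
    · simpa using hst.r12
    · simpa using hst.r13
    · simpa using hst.r14
    · simp [hok]; omega
  clear hst st
  rintro st ⟨hst, h21⟩
  have hl := hst.loaded
  have hnodeN := F.lt_of_getElem? hlab
  refine Run.block_arith (D.node u + 1) (by simp [Op.eval, hst.r13, hl.r1]) (hsmall (by omega)) ?_
  refine Run.block_load i₀ (by simpa using getD_of_getElem? hlab) (hsmall (by omega)) ?_
  refine Run.block_arith (D.text + i₀) (by simp [Op.eval, hl.r3, add_comm]) (hsmall (by omega)) ?_
  refine Run.block_const (hsmall (by omega)) ?_
  refine Run.block_cons (R := fun st' => X.At P.length u st' ∧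
    st'.reg 21 = if P <:+: T then 1 else 0) ?_ fun st' hst' => h st' hst'.1 hst'.2
  refine Run.mono (Run.loop (b := 9) (Inv := fun k st => X.At P.length u st ∧
    st.reg 22 = D.text + i₀ ∧ k ≤ P.length ∧ st.reg 15 = P.length - k ∧
    st.reg 21 = if ok (P.length - k) then 1 else 0) ?_ ?_ P.length ?_) le_rfl ?_
  · clear h21 hst hl
    rintro k st ⟨hst, h22, hk, h15, h21⟩
    have hl := hst.loaded
    obtain ⟨j, hj⟩ : ∃ j, j = P.length - (k + 1) := ⟨_, rfl⟩
    rw [← hj] at h15 h21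
    have hjk : P.length - k = j + 1 := by omega
    refine ⟨by rw [h15, hst.r12]; omega, ?_⟩
    have hcode := letterCode_le (P := P) j
    have hσ := F.sigma_le
    refine Run.block_arith (D.text + i₀ + j) (by simp [Op.eval, h22, h15]) (hsmall (by omega)) ?_
    refine Run.block_load (M.getD (D.text + i₀ + j) 0) (by simp)
      (hsmall ((F.getD_le _).trans (by omega))) ?_
    refine Run.block_letter (letterCode P j) (by simp [h15]) (hsmall (by omega)) ?_
    refine Run.block_arith (letterCode P j - 1) (by simp [Op.eval, hl.r1]) (hsmall (by omega)) ?_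
    refine Run.block_cons (R := fun st' => X.At P.length u st' ∧ st'.reg 22 = D.text + i₀ ∧
      st'.reg 15 = j ∧ st'.reg 21 = if ok (j + 1) then 1 else 0) (b₁ := 3) (b₂ := 2)
      (Run.cond (b := 2) (fun hc => ?_) (fun hc => Run.cond (b := 1) (fun hc' => ?_)
      (fun hc' => ?_))) ?_
    · simp at hc
      have hno : ¬ ok (j + 1) := by rw [hok_succ, List.getD_eq_getElem?_getD]; omega
      rw [if_neg hno]
      refine Run.mono (Run.const (Q := fun st' => X.At P.length u st' ∧ st'.reg 22 = D.text + i₀ ∧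
        st'.reg 15 = j ∧ st'.reg 21 = 0) (hsmall (by omega)) ?_) (by omega) fun _ h => h
      refine ⟨⟨?_, by simpa using hst.out, by simpa using hst.r12, by simpa using hst.r13,
        by simpa using hst.r14⟩, by simpa using h22, by simpa using h15, by simp⟩
      repeat' refine QueryWords.Loaded.set ?_ (by omega) _
      exact hl
    · simp at hc'
      have hno : ¬ ok (j + 1) := by rw [hok_succ, List.getD_eq_getElem?_getD]; omega
      rw [if_neg hno]
      refine Run.const (hsmall (by omega)) ⟨⟨?_, by simpa using hst.out, by simpa using hst.r12,
        by simpa using hst.r13, by simpa using hst.r14⟩, by simpa using h22, by simpa using h15,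
        by simp⟩
      repeat' refine QueryWords.Loaded.set ?_ (by omega) _
      exact hl
    · simp at hc hc'
      have hiff : ok (j + 1) ↔ ok j := by
        rw [hok_succ, List.getD_eq_getElem?_getD, and_iff_left_iff_imp]
        intro _
        omega
      refine Run.skip (hsmall (by omega)) ⟨⟨?_, by simpa using hst.out, by simpa using hst.r12,
        by simpa using hst.r13, by simpa using hst.r14⟩, by simpa using h22, by simpa using h15,
        by simpa [hiff] using h21⟩
      repeat' refine QueryWords.Loaded.set ?_ (by omega) _
      exact hl
    · rintro st' ⟨hst', h22', h15', h21'⟩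
      have hl' := hst'.loaded
      refine Run.block_arith (j + 1) (by simp [Op.eval, h15', hl'.r1]) (hsmall (by omega)) ?_
      refine Run.block_nil (hsmall (by omega)) ⟨⟨?_, by simpa using hst'.out,
        by simpa using hst'.r12, by simpa using hst'.r13, by simpa using hst'.r14⟩,
        by simpa using h22', by omega, by simp [hjk], by simpa [hjk] using h21'⟩
      repeat' refine QueryWords.Loaded.set ?_ (by omega) _
      exact hl'
  · rintro st ⟨hst, -, -, h15, -⟩
    rw [h15, hst.r12]
    omega
  · refine ⟨⟨?_, by simpa using hst.out, by simpa using hst.r12, by simpa using hst.r13,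
        by simpa using hst.r14⟩, by simp, le_rfl, by simp, by simpa using h21⟩
    repeat' refine QueryWords.Loaded.set ?_ (by omega) _
    exact hl
  · rintro st ⟨hst, -, -, -, h21⟩
    refine ⟨hst, ?_⟩
    rw [h21]
    simp only [Nat.sub_zero, hok_all]

theorem le_getElem_of_pairwise_lt {l : List ℕ} (h : l.Pairwise (· < ·)) {i : ℕ}
    (hi : i < l.length) : i ≤ l[i] := by
  induction i with
  | zero => omega
  | succ i ih =>
    have h1 := ih (by omega)
    have h2 := List.pairwise_iff_getElem.1 h i (i + 1) (by omega) hi (by omega)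
    omega

/-- At the locus of a pattern that occurs, the final segment of the list of its period path is
output. Slots that end above the pattern are skipped; there are at most `|P|` of them. -/
theorem run_report (X : QueryWords D) (F : Fits σ M N W) {u : List (Option (Fin σ))}
    {p : List (Fin σ)} (hP : P ∈ periodPath T p) (hu : IsLocus T P u) {st : State}
    (hst : X.At P.length u st) {L : List (ℕ × ℕ)}
    (hL : L = (D.seqs p).drop ((D.seqs p).countP fun y => seqLength y < P.length)) :
    Run W M P report st (P.length * 5 + L.length * 8 + 11)
      (fun st' => st'.out = L.flatMap fun x => [x.1, x.2]) := by
  have hN := F.four_le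
  have hsmall : ∀ {y}, y ≤ 4 * N → y < W := fun hy => F.four_mul_lt hy
  have hl := hst.loaded
  have hnode := hu.1
  obtain ⟨E, hE⟩ : ∃ E, E = X.ends u := ⟨_, rfl⟩
  have hEsorted : E.Pairwise (· < ·) := hE ▸ X.ends_sorted u
  obtain ⟨l₀, hl₀, hPl₀⟩ := exists_isPathEnd hP hu
  have hmem₀ : ∃ l ∈ E, decide (P.length ≤ l) = true :=
    ⟨l₀, hE ▸ (X.mem_ends u l₀ hnode).2 ⟨p, hl₀⟩, by simpa using hPl₀⟩
  obtain ⟨j, hj⟩ : ∃ j, j = E.findIdx fun l => decide (P.length ≤ l) := ⟨_, rfl⟩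
  have hjlen : j < E.length := hj ▸ List.findIdx_lt_length_of_exists hmem₀
  have hbefore : ∀ i (hi : i < j), E[i] < P.length := by
    intro i hi
    have := List.not_of_lt_findIdx (hj ▸ hi)
    simpa using this
  obtain ⟨l, hl'⟩ : ∃ l, E[j]? = some l := ⟨_, List.getElem?_eq_getElem hjlen⟩
  have hEl : E[j] = l := (List.getElem?_eq_some_iff.1 hl').2
  have hPl : P.length ≤ l := by
    have := List.findIdx_getElem (w := hj ▸ hjlen)
    simp only [← hj, hEl] at this
    simpa using this
  have hend : IsPathEnd T u p l := by
    refine isPathEnd_of_first hP hu ((X.mem_ends u l hnode).1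
      (hE ▸ List.mem_of_getElem? hl')) hPl fun l' hex hle => ?_
    obtain ⟨i, hi, rfl⟩ := List.mem_iff_getElem.1 (hE ▸ (X.mem_ends u l' hnode).2 hex)
    rcases lt_trichotomy i j with h | h | h
    · exact absurd (hbefore i h) (by omega)
    · subst h; omega
    · have := List.pairwise_iff_getElem.1 hEsorted j i hjlen hi h
      omega
  -- the slots that are skipped end at different lengths below `|P|`
  have hjm : j ≤ P.length := by
    rcases Nat.eq_zero_or_pos j with h | h
    · omega
    · have h1 := le_getElem_of_pairwise_lt hEsorted (i := j - 1) (by omega)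
      have h2 := hbefore (j - 1) (by omega)
      omega
  have hends : ∀ i l', E[i]? = some l' → M[D.node u + 3 + 3 * i + 1]? = some l' :=
    fun i l' h => X.ends_eq u i l' hnode (hE ▸ h)
  have hcount : (D.seqs p).countP (fun y => decide (seqLength y < l)) =
      (D.seqs p).countP fun y => decide (seqLength y < P.length) := by
    obtain ⟨x, hx, hxu, rfl⟩ := hend.1
    refine List.countP_congr fun y hy => ?_
    simpa using seqLength_lt_iff_of_isLocus hx hP hxu hu ((D.mem_seqs p y).1 hy)
  obtain ⟨cnt, hcnt⟩ : ∃ cnt, cnt = (D.seqs p).countP fun y => decide (seqLength y < P.length) :=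
    ⟨_, rfl⟩
  rw [← hcnt] at hL hcount
  have hcntle : cnt ≤ (D.seqs p).length := hcnt ▸ List.countP_le_length
  have hptr := X.ptr_eq u j p l hend hnode (hE ▸ hl')
  rw [hcount] at hptr
  have hlast := X.last_eq u j p l hend hnode (hE ▸ hl')
  have hLlen : cnt + L.length = (D.seqs p).length := by rw [hL, List.length_drop]; omega
  have hlastN := F.le_of_getElem? hlast
  obtain ⟨e₀, he₀⟩ : ∃ e₀, E[0]? = some e₀ := ⟨_, List.getElem?_eq_getElem (by omega)⟩
  have hfirst := hends 0 e₀ he₀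
  have hfirstN := F.lt_of_getElem? hfirst
  have hfirstN' := F.le_of_getElem? hfirst
  rw [report]
  refine Run.mono (b₁ := (1 + (L.length * 8 + 1) + 1 + 1 + 1 + 1) + (j * 5 + 1) + 1 + 1 + 1 + 1)
    (Q := fun st' => st'.out = L.flatMap fun x => [x.1, x.2]) ?_ (by omega) fun _ h => h
  refine Run.block_const (hsmall (by omega)) ?_
  refine Run.block_arith (D.node u + 3) (by simp [Op.eval, hst.r13]) (hsmall (by omega)) ?_
  refine Run.block_arith (D.node u + 3 + 1) (by simp [Op.eval, hl.r1]) (hsmall (by omega)) ?_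
  refine Run.block_load e₀ (by simpa using getD_of_getElem? hfirst) (hsmall (by omega)) ?_
  refine Run.block_cons (R := fun st' => X.Loaded st' ∧ st'.out = [] ∧
    st'.reg 15 = D.node u + 3 + 3 * j) (b₁ := j * 5 + 1)
    (Run.mono (Run.loop (b := 4) (Inv := fun k st' => X.Loaded st' ∧ st'.out = [] ∧
      st'.reg 12 = P.length ∧ st'.reg 23 = 3 ∧ k ≤ j ∧ st'.reg 15 = D.node u + 3 + 3 * (j - k) ∧
      E[j - k]? = some (st'.reg 16)) ?_ ?_ j ?_) le_rfl ?_) ?_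
  · rintro k st ⟨hl, hout, h12, h23, hk, h15, h16⟩
    obtain ⟨hi, hEi⟩ := List.getElem?_eq_some_iff.1 h16
    refine ⟨by rw [h12, ← hEi]; exact hbefore _ (by omega), ?_⟩
    obtain ⟨i, hik⟩ : ∃ i, i = j - (k + 1) := ⟨_, rfl⟩
    rw [← hik] at h15
    have hik' : j - k = i + 1 := by omega
    obtain ⟨e, he⟩ : ∃ e, E[i + 1]? = some e := ⟨_, List.getElem?_eq_getElem (by omega)⟩
    have hnext := hends (i + 1) e he
    have hnextN := F.lt_of_getElem? hnext
    have hnextN' := F.le_of_getElem? hnext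
    refine Run.block_arith (D.node u + 3 + 3 * (i + 1)) (by simp [Op.eval, h15, h23]; ring)
      (hsmall (by omega)) ?_
    refine Run.block_arith (D.node u + 3 + 3 * (i + 1) + 1) (by simp [Op.eval, hl.r1])
      (hsmall (by omega)) ?_
    refine Run.block_load e (by simpa using getD_of_getElem? hnext) (hsmall (by omega)) ?_
    refine Run.block_nil (hsmall (by omega)) ⟨?_, by simpa using hout, by simpa using h12,
      by simpa using h23, by omega, by simp [hik'], by simpa [hik'] using he⟩
    repeat' refine QueryWords.Loaded.set ?_ (by omega) _
    exact hl
  · rintro st ⟨-, -, h12, -, -, -, h16⟩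
    rw [Nat.sub_zero, hl'] at h16
    rw [h12, ← Option.some.inj h16]
    omega
  · refine ⟨?_, by simpa using hst.out, by simpa using hst.r12, by simp, le_rfl, by simp,
      by simpa using he₀⟩
    repeat' refine QueryWords.Loaded.set ?_ (by omega) _
    exact hl
  · rintro st ⟨hl, hout, -, -, -, h15, -⟩
    exact ⟨hl, hout, by simpa using h15⟩
  clear hst hl st
  rintro st ⟨hl, hout, h15⟩
  have hlastA := F.lt_of_getElem? hlast
  refine Run.block_load (D.list p + 2 * cnt) (by rw [h15]; exact getD_of_getElem? hptr)
    (hsmall (by omega)) ?_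
  refine Run.block_arith (D.node u + 3 + 3 * j + 1) (by simp [Op.eval, h15, hl.r1])
    (hsmall (by omega)) ?_
  refine Run.block_arith (D.node u + 3 + 3 * j + 2) (by simp [Op.eval, hl.r1])
    (hsmall (by omega)) ?_
  refine Run.block_load (D.list p + 2 * (D.seqs p).length) (by simpa using getD_of_getElem? hlast)
    (hsmall (by omega)) ?_
  refine Run.mono (b₁ := 1 + (L.length * 8 + 1)) (Run.block_cons (R := fun st' =>
    st'.out = L.flatMap fun x => [x.1, x.2]) (Run.mono (Run.loop (b := 7) (Inv := fun k st' =>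
      st'.reg 1 = 1 ∧ k ≤ L.length ∧ st'.reg 17 = D.list p + 2 * (cnt + (L.length - k)) ∧
      st'.reg 18 = D.list p + 2 * (D.seqs p).length ∧
      st'.out = (L.take (L.length - k)).flatMap fun x => [x.1, x.2]) ?_ ?_ L.length ?_) le_rfl ?_)
      ?_) (by omega) fun _ h => h
  · clear hl hout h15 st
    rintro k st ⟨h1, hk, h17, h18, hout⟩
    refine ⟨by rw [h17, h18]; omega, ?_⟩
    obtain ⟨i, hi⟩ : ∃ i, i = L.length - (k + 1) := ⟨_, rfl⟩
    rw [← hi] at h17 hout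
    have hik : L.length - k = i + 1 := by omega
    obtain ⟨x, hx⟩ : ∃ x, L[i]? = some x := ⟨_, List.getElem?_eq_getElem (by omega)⟩
    have hx' : (D.seqs p)[cnt + i]? = some x := by rw [← List.getElem?_drop, ← hL, hx]
    obtain ⟨hM1, hM2⟩ := D.list_eq p _ x hx'
    have hN1 := F.le_of_getElem? hM1
    have hN2 := F.le_of_getElem? hM2
    have hA2 := F.lt_of_getElem? hM2
    refine Run.block_load x.1 (by rw [h17]; exact getD_of_getElem? hM1) (hsmall (by omega)) ?_
    refine Run.block_output x.1 (by simp) ?_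
    refine Run.block_arith (D.list p + 2 * (cnt + i) + 1) (by simp [Op.eval, h17, h1])
      (hsmall (by omega)) ?_
    refine Run.block_load x.2 (by simpa using getD_of_getElem? hM2) (hsmall (by omega)) ?_
    refine Run.block_output x.2 (by simp) ?_
    refine Run.block_arith (D.list p + 2 * (cnt + (i + 1))) (by simp [Op.eval, h1]; ring)
      (hsmall (by omega)) ?_
    refine Run.block_nil (hsmall (by omega)) ⟨by simpa using h1, by omega, by simp [hik],
      by simpa using h18, ?_⟩
    rw [hik, List.take_add_one, hx, List.flatMap_append, ← hout]
    simp
  · rintro st ⟨-, -, h17, h18, -⟩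
    rw [h17, h18]
    omega
  · exact ⟨by simpa using hl.r1, le_rfl, by simp, by simp, by simpa using hout⟩
  · rintro st ⟨-, -, -, -, hout⟩
    simpa using hout
  · intro st' hout'
    exact Run.block_nil (hsmall (by omega)) (by simpa using hout')

/-- The query program outputs the period sequences of the path of `P` that are at least as long as
`P`, in time proportional to the sum of the lengths of the input and the output. -/
theorem exists_outputs_query (X : QueryWords D) (F : Fits σ M N W) (hP : IsPeriodicPattern P)
    {p : List (Fin σ)} (hp : IsShortestPeriod p P) {L : List (ℕ × ℕ)}
    (hL : L = (D.seqs p).drop ((D.seqs p).countP fun y => seqLength y < P.length))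
    (hocc : L ≠ [] → P <:+: T) :
    ∃ t, Outputs W M P query t L ∧ t ≤ 200 * (P.length + L.length) := by
  classical
  have hN := F.four_le
  have hPpos : 0 < P.length := hp.1.length_pos.trans_le hp.1.isPrefix.length_le
  have hPne : P ≠ [] := List.length_pos_iff.1 hPpos
  have hempty : ¬ P <:+: T → L = [] := fun h => by_contra fun h' => h (hocc h')
  have key : Run W M P query State.init (200 * (P.length + L.length))
      (fun st => st.out = L.flatMap fun x => [x.1, x.2]) := by
    rw [query, List.append_assoc]
    refine Run.mono (run_readHeader X F (Q := fun st => st.out = L.flatMap fun x => [x.1, x.2])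
      (b := 1 + ((P.length * 49 + L.length * 8 + 25) + 1) + (P.length * 6 + 1) + 2)
      fun st hl h13 hout => ?_) (by omega) fun _ h => h
    refine run_measure X F hl h13 hout ?_
    clear hl h13 hout st
    intro st hl h13 hout h12
    refine Run.block_cons (R := fun st => st.out = L.flatMap fun x => [x.1, x.2])
      (Run.cond (fun hc => ?_) (fun hc => ?_))
      fun st' h => Run.block_nil (F.four_mul_lt (by omega)) (by simpa using h)
    · rw [hl.r2, h12] at hc
      have : L = [] := hempty fun h => by have := h.length_le; omega
      refine Run.mono (Run.skip (F.four_mul_lt (by omega))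
        (Q := fun st => st.out = L.flatMap fun x => [x.1, x.2]) ?_) (by omega) fun _ h => h
      simp [hout, this]
    · rw [hl.r2, h12] at hc
      have hPT : P.length ≤ T.length := by omega
      rw [List.append_assoc]
      refine Run.mono (run_walk X F (b := 1 + (P.length * 5 + L.length * 8 + 11 + 1) +
        (P.length * 10 + 1) + 1 + 1 + 1 + 1 + 2)
        (Q := fun st => st.out = L.flatMap fun x => [x.1, x.2]) hl hout
        (by rw [h12]; omega) h13 hPT fun u st' hu huL hat => ?_) (by omega) fun _ h => h
      refine run_verify X F hu huL hPne hPT hat fun st'' hat' h21 => ?_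
      refine Run.block_cons (R := fun st => st.out = L.flatMap fun x => [x.1, x.2])
        (Run.cond (fun hc => ?_) (fun hc => ?_))
        fun st' h => Run.block_nil (F.four_mul_lt (by omega)) (by simpa using h)
      · rw [hat'.loaded.r0, h21] at hc
        have hinf : P <:+: T := by by_contra h; simp [h] at hc
        obtain ⟨v, hv⟩ := exists_isLocus hinf
        rw [huL v hv] at hat'
        exact run_report X F ⟨hinf, hP, hp⟩ hv hat' hL
      · rw [hat'.loaded.r0, h21] at hc
        have hinf : ¬ P <:+: T := by intro h; simp [h] at hc
        refine Run.mono (Run.skip (F.four_mul_lt (by omega))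
          (Q := fun st => st.out = L.flatMap fun x => [x.1, x.2]) ?_) (by omega) fun _ h => h
        simp [hat'.out, hempty hinf]
  obtain ⟨t, st', ht, he, hQ⟩ := key
  exact ⟨t, ⟨st', he, hQ⟩, ht⟩

end QueryCorrect

/-! ### The parts of the data structure -/

section Construction

variable {σ : ℕ} (T : List (Fin σ))

/-- The nodes of the suffix tree. -/
noncomputable def nodeSet : Finset (List (Option (Fin σ))) := (exists_finset_isNode T).choose

theorem mem_nodeSet {T : List (Fin σ)} {v : List (Option (Fin σ))} :
    v ∈ nodeSet T ↔ IsNode T v := (exists_finset_isNode T).choose_spec.1 v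

theorem card_nodeSet_le : (nodeSet T).card ≤ 2 * (T.length + 2) :=
  (exists_finset_isNode T).choose_spec.2

open Classical in
/-- The lengths at which the period paths that meet the edge above `v` end. -/
noncomputable def pathEnds (v : List (Option (Fin σ))) : Finset ℕ :=
  if h : v.length ≤ T.length + 1 then (exists_finset_isPathEnd T v h).choose else ∅

theorem mem_pathEnds {T : List (Fin σ)} {v : List (Option (Fin σ))} (hv : IsNode T v) {l : ℕ} :
    l ∈ pathEnds T v ↔ ∃ p, IsPathEnd T v p l := by
  rw [pathEnds, dif_pos hv.length_le]
  exact (exists_finset_isPathEnd T v hv.length_le).choose_spec.1 l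

theorem card_pathEnds_le (v : List (Option (Fin σ))) :
    (pathEnds T v).card ≤ 2 * (Nat.log 2 (T.length + 1) + 1) := by
  rw [pathEnds]
  split_ifs with h
  · exact (exists_finset_isPathEnd T v h).choose_spec.2
  · simp

/-- All period sequences of the text. -/
noncomputable def runs : Finset (ℕ × ℕ) := (exists_finset_isPeriodSequence T).choose

theorem mem_runs {T : List (Fin σ)} {x : ℕ × ℕ} :
    x ∈ runs T ↔ ∃ p, IsPeriodSequence T p x.1 x.2 :=
  (exists_finset_isPeriodSequence T).choose_spec.1 x

theorem card_runs_le : (runs T).card ≤ 2 * (Nat.log 2 T.length + 1) * T.length :=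
  (exists_finset_isPeriodSequence T).choose_spec.2

open Classical in
/-- The period sequences with period `p`, sorted by length. -/
noncomputable def seqsOf (p : List (Fin σ)) : List (ℕ × ℕ) :=
  ((runs T).filter fun x => IsPeriodSequence T p x.1 x.2).toList.insertionSort
    fun x y => seqLength x ≤ seqLength y

theorem mem_seqsOf {T p : List (Fin σ)} {x : ℕ × ℕ} :
    x ∈ seqsOf T p ↔ IsPeriodSequence T p x.1 x.2 := by
  classical
  rw [seqsOf, List.mem_insertionSort, Finset.mem_toList, Finset.mem_filter, mem_runs,
    and_iff_right_iff_imp]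
  exact fun h => ⟨p, h⟩

theorem nodup_seqsOf (p : List (Fin σ)) : (seqsOf T p).Nodup :=
  (List.perm_insertionSort _ _).nodup_iff.2 (Finset.nodup_toList _)

theorem sorted_seqsOf (p : List (Fin σ)) :
    (seqsOf T p).Pairwise fun x y => seqLength x ≤ seqLength y := by
  have : Std.Total fun x y : ℕ × ℕ => seqLength x ≤ seqLength y := ⟨fun x y => le_total _ _⟩
  have : IsTrans (ℕ × ℕ) fun x y => seqLength x ≤ seqLength y := ⟨fun x y z => le_trans⟩
  exact List.pairwise_insertionSort _ _

open Classical in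
/-- The periods of the period sequences. -/
noncomputable def periodSet : Finset (List (Fin σ)) :=
  (runs T).image fun x => if h : ∃ p, IsPeriodSequence T p x.1 x.2 then h.choose else []

theorem mem_periodSet {T p : List (Fin σ)} {s e : ℕ} (h : IsPeriodSequence T p s e) :
    p ∈ periodSet T := by
  have hex : ∃ p, IsPeriodSequence T p s e := ⟨p, h⟩
  refine Finset.mem_image.2 ⟨(s, e), mem_runs.2 hex, ?_⟩
  rw [dif_pos hex]
  exact hex.choose_spec.period_unique h

theorem sum_length_seqsOf_le :
    ∑ p ∈ periodSet T, 2 * (seqsOf T p).length ≤ 2 * (runs T).card := by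
  classical
  rw [← Finset.mul_sum]
  refine Nat.mul_le_mul_left 2 ?_
  have h : ∀ p, (seqsOf T p).length =
      ((runs T).filter fun x => IsPeriodSequence T p x.1 x.2).card := by
    intro p
    rw [seqsOf, List.length_insertionSort, Finset.length_toList]
  simp only [h]
  rw [← Finset.card_biUnion]
  · refine Finset.card_le_card fun x hx => ?_
    obtain ⟨p, -, hx⟩ := Finset.mem_biUnion.1 hx
    exact (Finset.mem_filter.1 hx).1
  · intro p _ p' _ hpp'
    rw [Function.onFun, Finset.disjoint_left]
    intro x hx hx'
    exact hpp' ((Finset.mem_filter.1 hx).2.period_unique (Finset.mem_filter.1 hx').2)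

/-! ### Addresses -/

/-- The length of the record of a node: three words, and three words for each slot. -/
noncomputable def nodeWidth (v : List (Option (Fin σ))) : ℕ := 3 + 3 * (pathEnds T v).card

/-- The addresses of the records of the nodes, relative to the first one. -/
noncomputable def nodeOffset : List (Option (Fin σ)) → ℕ :=
  (exists_layout (nodeWidth T) (nodeSet T).toList).choose

/-- The addresses of the lists, relative to the first one. -/
noncomputable def listOffset : List (Fin σ) → ℕ :=
  (exists_layout (fun p => 2 * (seqsOf T p).length) (periodSet T).toList).choose

/-- The address of the record of a node. The header and the text come first. -/
noncomputable def nodeAddr (v : List (Option (Fin σ))) : ℕ := 11 + (T.length + 1) + nodeOffset T v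

/-- The address behind the records of the nodes. -/
noncomputable def listBase : ℕ := 11 + (T.length + 1) + ∑ v ∈ nodeSet T, nodeWidth T v

open Classical in
/-- The address of the list of period sequences with period `p`; `0` if there are none. -/
noncomputable def listAddr (p : List (Fin σ)) : ℕ :=
  if p ∈ periodSet T then listBase T + listOffset T p else 0

/-- The address behind the lists. -/
noncomputable def tableBase : ℕ := listBase T + ∑ p ∈ periodSet T, 2 * (seqsOf T p).length

theorem nodeAddr_add_le {T : List (Fin σ)} {v : List (Option (Fin σ))} (hv : IsNode T v) :
    nodeAddr T v + nodeWidth T v ≤ listBase T := by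
  have h : nodeOffset T v + nodeWidth T v ≤ ((nodeSet T).toList.map (nodeWidth T)).sum :=
    (exists_layout (nodeWidth T) (nodeSet T).toList).choose_spec.1 v
      (Finset.mem_toList.2 (mem_nodeSet.2 hv))
  rw [Finset.sum_map_toList] at h
  change _ ≤ ∑ v ∈ nodeSet T, nodeWidth T v at h
  unfold nodeAddr listBase
  omega

theorem nodeAddr_disjoint {T : List (Fin σ)} {u v : List (Option (Fin σ))} (hu : IsNode T u)
    (hv : IsNode T v) (huv : u ≠ v) : nodeAddr T u + nodeWidth T u ≤ nodeAddr T v ∨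
      nodeAddr T v + nodeWidth T v ≤ nodeAddr T u := by
  have h := (exists_layout (nodeWidth T) (nodeSet T).toList).choose_spec.2.1 u
    (Finset.mem_toList.2 (mem_nodeSet.2 hu)) v (Finset.mem_toList.2 (mem_nodeSet.2 hv)) huv
  unfold nodeAddr nodeOffset
  omega

theorem nodeAddr_injective {T : List (Fin σ)} {u v : List (Option (Fin σ))} (hu : IsNode T u)
    (hv : IsNode T v) (h : nodeAddr T u = nodeAddr T v) : u = v := by
  by_contra huv
  have := nodeAddr_disjoint hu hv huv
  unfold nodeWidth at this
  omega

theorem listAddr_add_le (p : List (Fin σ)) :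
    listAddr T p + 2 * (seqsOf T p).length ≤ tableBase T := by
  by_cases hp : p ∈ periodSet T
  · have h : listOffset T p + 2 * (seqsOf T p).length ≤
        ((periodSet T).toList.map fun p => 2 * (seqsOf T p).length).sum :=
      (exists_layout (fun p => 2 * (seqsOf T p).length)
        (periodSet T).toList).choose_spec.1 p (Finset.mem_toList.2 hp)
    rw [Finset.sum_map_toList] at h
    unfold listAddr tableBase
    rw [if_pos hp]
    omega
  · have hnil : seqsOf T p = [] :=
      List.eq_nil_iff_forall_not_mem.2 fun x hx => hp (mem_periodSet (mem_seqsOf.1 hx))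
    simp [listAddr, hp, hnil]

/-! ### Records and lists -/

open Classical in
/-- The period of the path that ends at length `l` in the edge above `v`. -/
noncomputable def pathPeriod (v : List (Option (Fin σ))) (l : ℕ) : List (Fin σ) :=
  if h : ∃ p, IsPathEnd T v p l then h.choose else []

theorem pathPeriod_eq {T p : List (Fin σ)} {v : List (Option (Fin σ))} {l : ℕ}
    (h : IsPathEnd T v p l) : pathPeriod T v l = p := by
  have hex : ∃ p, IsPathEnd T v p l := ⟨p, h⟩
  rw [pathPeriod, dif_pos hex]
  exact hex.choose_spec.period_unique h

/-- The lengths at which the period paths that meet the edge above `v` end, sorted. -/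
noncomputable def sortedEnds (v : List (Option (Fin σ))) : List ℕ := (pathEnds T v).sort (· ≤ ·)

/-- The slot of the path that ends at length `l`: the pointer into the list of the path, the length
`l`, and the address of the end of the list. -/
noncomputable def slotWords (v : List (Option (Fin σ))) (l : ℕ) : List ℕ :=
  [listAddr T (pathPeriod T v l) +
      2 * (seqsOf T (pathPeriod T v l)).countP fun y => seqLength y < l,
    l, listAddr T (pathPeriod T v l) + 2 * (seqsOf T (pathPeriod T v l)).length]

open Classical in
/-- A place at which the string of a node occurs. -/
noncomputable def labelOf (v : List (Option (Fin σ))) : ℕ :=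
  if h : IsNode T v then h.exists_occursAt.choose else 0

open Classical in
/-- The address of the parent; `0` at the root. -/
noncomputable def parentAddr (v : List (Option (Fin σ))) : ℕ :=
  if h : ∃ u, IsParent T u v then nodeAddr T h.choose else 0

/-- The record of a node. -/
noncomputable def nodeRecord (v : List (Option (Fin σ))) : List ℕ :=
  [v.length, labelOf T v, parentAddr T v] ++ (sortedEnds T v).flatMap (slotWords T v)

/-- The words that store a list of period sequences. -/
noncomputable def listWords (p : List (Fin σ)) : List ℕ :=
  (seqsOf T p).flatMap fun x => [x.1, x.2]

theorem labelOf_spec {T : List (Fin σ)} {v : List (Option (Fin σ))} (hv : IsNode T v) :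
    labelOf T v + v.length ≤ T.length + 1 ∧ OccursAt v (marked T) (labelOf T v) := by
  rw [labelOf, dif_pos hv]
  exact hv.exists_occursAt.choose_spec

theorem parentAddr_eq {T : List (Fin σ)} {u v : List (Option (Fin σ))} (h : IsParent T u v) :
    parentAddr T v = nodeAddr T u := by
  have hex : ∃ u, IsParent T u v := ⟨u, h⟩
  rw [parentAddr, dif_pos hex, hex.choose_spec.unique h]

theorem getElem?_flatMap_of_length {ι : Type*} {g : ι → List ℕ} {k : ℕ}
    (hg : ∀ x, (g x).length = k) {l : List ι} {i : ℕ} {x : ι} (hx : l[i]? = some x) {j : ℕ}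
    (hj : j < k) : (l.flatMap g)[k * i + j]? = (g x)[j]? := by
  induction l generalizing i with
  | nil => simp at hx
  | cons a l ih =>
    rw [List.flatMap_cons]
    cases i with
    | zero =>
      simp only [List.getElem?_cons_zero, Option.some.injEq] at hx
      subst hx
      rw [mul_zero, zero_add, List.getElem?_append_left (by rw [hg]; exact hj)]
    | succ i =>
      rw [List.getElem?_cons_succ] at hx
      rw [List.getElem?_append_right (by rw [hg, mul_add]; omega), ← ih hx, hg]
      congr 1
      rw [mul_add]
      omega

theorem length_flatMap_of_length {ι : Type*} {g : ι → List ℕ} {k : ℕ}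
    (hg : ∀ x, (g x).length = k) (l : List ι) : (l.flatMap g).length = k * l.length := by
  simp [List.length_flatMap, hg, mul_comm]

theorem length_nodeRecord (v : List (Option (Fin σ))) :
    (nodeRecord T v).length = nodeWidth T v := by
  rw [nodeRecord, List.length_append, length_flatMap_of_length (k := 3) (fun _ => rfl), sortedEnds,
    Finset.length_sort, nodeWidth]
  rfl

theorem length_listWords (p : List (Fin σ)) :
    (listWords T p).length = 2 * (seqsOf T p).length :=
  length_flatMap_of_length (k := 2) (fun _ => rfl) _

/-- The records of all nodes. -/
noncomputable def nodePart : List ℕ := (nodeSet T).toList.flatMap (nodeRecord T)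

/-- The lists of all period paths. -/
noncomputable def listPart : List ℕ := (periodSet T).toList.flatMap (listWords T)

theorem length_nodePart : (nodePart T).length = ∑ v ∈ nodeSet T, nodeWidth T v := by
  rw [nodePart, ((exists_layout (nodeWidth T) (nodeSet T).toList).choose_spec.2.2 (nodeRecord T)
    fun v _ => length_nodeRecord T v).1, Finset.sum_map_toList]

theorem length_listPart :
    (listPart T).length = ∑ p ∈ periodSet T, 2 * (seqsOf T p).length := by
  rw [listPart, ((exists_layout (fun p => 2 * (seqsOf T p).length)
    (periodSet T).toList).choose_spec.2.2 (listWords T) fun p _ => length_listWords T p).1,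
    Finset.sum_map_toList]

theorem getElem?_nodePart {T : List (Fin σ)} {v : List (Option (Fin σ))} (hv : IsNode T v) {j : ℕ}
    (hj : j < nodeWidth T v) : (nodePart T)[nodeOffset T v + j]? = (nodeRecord T v)[j]? :=
  ((exists_layout (nodeWidth T) (nodeSet T).toList).choose_spec.2.2 (nodeRecord T)
    fun v _ => length_nodeRecord T v).2 v (Finset.mem_toList.2 (mem_nodeSet.2 hv)) j hj

theorem getElem?_listPart {T p : List (Fin σ)} (hp : p ∈ periodSet T) {j : ℕ}
    (hj : j < 2 * (seqsOf T p).length) :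
    (listPart T)[listOffset T p + j]? = (listWords T p)[j]? :=
  ((exists_layout (fun p => 2 * (seqsOf T p).length)
    (periodSet T).toList).choose_spec.2.2 (listWords T)
    fun p _ => length_listWords T p).2 p (Finset.mem_toList.2 hp) j hj

/-! ### The dictionary of children -/

/-- A perfect hash table that maps a node and a letter to the child of the node for that letter. The
key combines the address of the node and the code of the letter; every cell holds the address of
some node. -/
structure ChildTable where
  (q a s : ℕ)
  (A B O : ℕ → ℕ)
  tab : List ℕ
  q_pos : 0 < q
  q_le : q ≤ 2 * ((tableBase T + 1) * (σ + 1))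
  a_lt : a < q
  s_pos : 0 < s
  s_le : s ≤ (nodeSet T).card + 1
  bucket : ∀ b < s, A b < q ∧ 0 < B b ∧ O b + B b ≤ tab.length
  length_le : tab.length ≤ 5 * (nodeSet T).card + 1
  isNode : ∀ x ∈ tab, ∃ v, IsNode T v ∧ x = nodeAddr T v
  child : ∀ u (c : Fin σ) v, IsNode T u → IsStringLocus T (u ++ [some c]) v →
    tab[hashCell q a s A B O (nodeAddr T u * (σ + 1) + (c + 1))]? = some (nodeAddr T v)

theorem exists_childTable : Nonempty (ChildTable T) := by
  classical
  set key : List (Option (Fin σ)) → Fin σ → ℕ := fun u c => nodeAddr T u * (σ + 1) + (c + 1)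
    with hkey
  set IsChild : List (Option (Fin σ)) → Fin σ → List (Option (Fin σ)) → Prop := fun u c v =>
    IsNode T u ∧ IsStringLocus T (u ++ [some c]) v with hIsChild
  have key_inj : ∀ u c v u' c' v', IsChild u c v → IsChild u' c' v' → key u c = key u' c' →
      v = v' := by
    intro u c v u' c' v' h h' hk
    have hc := c.isLt
    have hc' := c'.isLt
    have h1 := congrArg (· / (σ + 1)) hk
    have h2 := congrArg (· % (σ + 1)) hk
    simp only [hkey] at h1 h2
    rw [mul_comm, Nat.mul_add_div (by omega), mul_comm, Nat.mul_add_div (by omega),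
      Nat.div_eq_of_lt (by omega), Nat.div_eq_of_lt (by omega)] at h1
    rw [mul_comm, Nat.mul_add_mod, mul_comm, Nat.mul_add_mod, Nat.mod_eq_of_lt (by omega),
      Nat.mod_eq_of_lt (by omega)] at h2
    obtain rfl := nodeAddr_injective h.1 h'.1 (by simpa using h1)
    obtain rfl : c = c' := Fin.ext (by omega)
    exact h.2.unique h'.2
  obtain ⟨Z, hZ⟩ : ∃ Z, Z = (tableBase T + 1) * (σ + 1) := ⟨_, rfl⟩
  have hZpos : Z ≠ 0 := by rw [hZ]; positivity
  obtain ⟨q, hq, hZq, hqZ⟩ := Nat.exists_prime_lt_and_le_two_mul Z hZpos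
  set C := (nodeSet T).filter fun v => ∃ z : List (Option (Fin σ)) × Fin σ, IsChild z.1 z.2 v
    with hC
  have hex : ∀ v ∈ C, ∃ z : List (Option (Fin σ)) × Fin σ, IsChild z.1 z.2 v :=
    fun v hv => (Finset.mem_filter.1 hv).2
  set keyOf : List (Option (Fin σ)) → ℕ := fun v =>
    if h : ∃ z : List (Option (Fin σ)) × Fin σ, IsChild z.1 z.2 v
    then key h.choose.1 h.choose.2 else 0 with hkeyOf
  have keyOf_eq : ∀ u c v, IsChild u c v → keyOf v = key u c := by
    intro u c v h
    have h' : ∃ z : List (Option (Fin σ)) × Fin σ, IsChild z.1 z.2 v := ⟨(u, c), h⟩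
    simp only [hkeyOf]
    rw [dif_pos h']
    obtain ⟨h1, h2⟩ := eq_of_isStringLocus_append h'.choose_spec.1 h.1 h'.choose_spec.2 h.2
    rw [h1, Option.some.inj h2]
  set f : ℕ → ℕ := fun x =>
    if h : ∃ v, ∃ z : List (Option (Fin σ)) × Fin σ, IsChild z.1 z.2 v ∧ x = key z.1 z.2
    then nodeAddr T h.choose else nodeAddr T [] with hf
  have f_eq : ∀ u c v, IsChild u c v → f (key u c) = nodeAddr T v := by
    intro u c v h
    have h' : ∃ v, ∃ z : List (Option (Fin σ)) × Fin σ,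
      IsChild z.1 z.2 v ∧ key u c = key z.1 z.2 := ⟨v, (u, c), h, rfl⟩
    simp only [hf]
    rw [dif_pos h']
    obtain ⟨z, hz, hk⟩ := h'.choose_spec
    rw [key_inj _ _ _ _ _ _ h hz hk]
  have f_node : ∀ x, ∃ v, IsNode T v ∧ f x = nodeAddr T v := by
    intro x
    simp only [hf]
    split_ifs with h
    · obtain ⟨z, hz, -⟩ := h.choose_spec
      exact ⟨_, hz.2.1, rfl⟩
    · exact ⟨[], isNode_nil T, rfl⟩
  have hcard : (C.image keyOf).card ≤ (nodeSet T).card :=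
    Finset.card_image_le.trans (Finset.card_filter_le _ _)
  have hlt : ∀ x ∈ C.image keyOf, x < q := by
    intro x hx
    obtain ⟨v, hv, rfl⟩ := Finset.mem_image.1 hx
    obtain ⟨⟨u, c⟩, h⟩ := hex v hv
    change IsChild u c v at h
    rw [keyOf_eq u c v h]
    refine lt_trans ?_ hZq
    have h1 : nodeAddr T u ≤ tableBase T := by
      have := nodeAddr_add_le h.1
      unfold tableBase
      omega
    have h2 := c.isLt
    have h3 := Nat.mul_le_mul_right (σ + 1) h1
    simp only [hkey]
    rw [hZ, add_mul, one_mul]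
    omega
  obtain ⟨a, s, A, B, O, tab, ha, hs, hs', hbucket, hlen, hval, hget⟩ :=
    exists_perfectHash hq (C.image keyOf) hlt f (nodeAddr T [])
  refine ⟨⟨q, a, s, A, B, O, tab, hq.pos, hZ ▸ hqZ, ha, hs, by omega, hbucket, by omega,
    fun x hx => ?_, fun u c v hu hv => ?_⟩⟩
  · rcases hval x hx with rfl | ⟨y, -, rfl⟩
    · exact ⟨[], isNode_nil T, rfl⟩
    · exact f_node y
  · have h : IsChild u c v := ⟨hu, hv⟩
    have hmem : key u c ∈ C.image keyOf :=
      Finset.mem_image.2 ⟨v, Finset.mem_filter.2 ⟨mem_nodeSet.2 hv.1, (u, c), h⟩,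
        keyOf_eq u c v h⟩
    rw [← f_eq u c v h]
    exact hget _ hmem

end Construction

/-! ### The array -/

section Array

variable {σ : ℕ} {T : List (Fin σ)} (H : ChildTable T)

/-- The first eleven words of the array. -/
noncomputable def ChildTable.header : List ℕ :=
  [T.length, 11, nodeAddr T [], σ + 1, H.q, H.a, H.s, tableBase T, tableBase T + H.s,
    tableBase T + 2 * H.s, tableBase T + 3 * H.s]

/-- The text, followed by a word that is not a letter. -/
def textPart (T : List (Fin σ)) : List ℕ := T.map Fin.val ++ [σ]

/-- The whole data structure. -/
noncomputable def ChildTable.array : List ℕ :=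
  H.header ++ textPart T ++ nodePart T ++ listPart T ++ (List.range H.s).map H.A ++
    (List.range H.s).map H.B ++ (List.range H.s).map H.O ++ H.tab

theorem ChildTable.length_header : H.header.length = 11 := rfl

theorem length_textPart : (textPart T).length = T.length + 1 := by simp [textPart]

theorem ChildTable.length_array : H.array.length = tableBase T + 3 * H.s + H.tab.length := by
  simp only [array, List.length_append, length_textPart, length_nodePart, length_listPart,
    List.length_map, List.length_range, tableBase, listBase, length_header]
  ring

theorem getElem?_of_append_prefix {pre X M : List ℕ} (h : pre ++ X <+: M) {k i : ℕ}
    (hk : pre.length = k) (hi : i < X.length) : M[k + i]? = X[i]? := by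
  rw [getElem?_eq_of_prefix h (by rw [List.length_append]; omega),
    List.getElem?_append_right (by omega), hk, Nat.add_sub_cancel_left]

theorem ChildTable.getElem?_text {i : ℕ} (hi : i < T.length + 1) :
    H.array[11 + i]? = (textPart T)[i]? :=
  getElem?_of_append_prefix (pre := H.header) (by simp [array]) rfl
    (by rwa [length_textPart])

theorem ChildTable.getElem?_node {v : List (Option (Fin σ))} (hv : IsNode T v) {j : ℕ}
    (hj : j < nodeWidth T v) : H.array[nodeAddr T v + j]? = (nodeRecord T v)[j]? := by
  have h := nodeAddr_add_le hv
  unfold nodeAddr listBase at h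
  rw [← getElem?_nodePart hv hj, nodeAddr, add_assoc]
  refine getElem?_of_append_prefix (pre := H.header ++ textPart T) (by simp [array]) ?_ ?_
  · simp [length_textPart, length_header]
  · rw [length_nodePart]
    omega

theorem ChildTable.getElem?_list {p : List (Fin σ)} {j : ℕ} (hj : j < 2 * (seqsOf T p).length) :
    H.array[listAddr T p + j]? = (listWords T p)[j]? := by
  have hp : p ∈ periodSet T := by
    obtain ⟨x, hx⟩ := List.exists_mem_of_length_pos (l := seqsOf T p) (by omega)
    exact mem_periodSet (mem_seqsOf.1 hx)
  have h := listAddr_add_le (T := T) p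
  unfold listAddr tableBase at h
  rw [if_pos hp] at h
  rw [← getElem?_listPart hp hj, listAddr, if_pos hp, add_assoc]
  refine getElem?_of_append_prefix (pre := H.header ++ textPart T ++ nodePart T)
    (by simp [array]) ?_ ?_
  · simp only [List.length_append, length_textPart, length_header, length_nodePart, listBase]
  · rw [length_listPart]
    omega

theorem ChildTable.length_prefix :
    (H.header ++ textPart T ++ nodePart T ++ listPart T).length = tableBase T := by
  simp only [List.length_append, length_textPart, length_header, length_nodePart, listBase,
    length_listPart, tableBase]

theorem ChildTable.getElem?_A {b : ℕ} (hb : b < H.s) :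
    H.array[tableBase T + b]? = some (H.A b) := by
  rw [getElem?_of_append_prefix (X := (List.range H.s).map H.A)
    (by simp [array]) H.length_prefix (by simpa using hb)]
  simp [hb]

theorem ChildTable.getElem?_B {b : ℕ} (hb : b < H.s) :
    H.array[tableBase T + H.s + b]? = some (H.B b) := by
  rw [getElem?_of_append_prefix (X := (List.range H.s).map H.B)
    (pre := H.header ++ textPart T ++ nodePart T ++ listPart T ++ (List.range H.s).map H.A)
    (by simp [array]) (by rw [List.length_append, H.length_prefix]; simp) (by simpa using hb)]
  simp [hb]

theorem ChildTable.getElem?_O {b : ℕ} (hb : b < H.s) :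
    H.array[tableBase T + 2 * H.s + b]? = some (H.O b) := by
  rw [getElem?_of_append_prefix (X := (List.range H.s).map H.O)
    (pre := H.header ++ textPart T ++ nodePart T ++ listPart T ++ (List.range H.s).map H.A ++
      (List.range H.s).map H.B) (by simp [array])
    (by rw [List.length_append, List.length_append, H.length_prefix]; simp; ring)
    (by simpa using hb)]
  simp [hb]

theorem ChildTable.getElem?_tab {i : ℕ} (hi : i < H.tab.length) :
    H.array[tableBase T + 3 * H.s + i]? = H.tab[i]? := by
  rw [getElem?_of_append_prefix (X := H.tab)
    (pre := H.header ++ textPart T ++ nodePart T ++ listPart T ++ (List.range H.s).map H.A ++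
      (List.range H.s).map H.B ++ (List.range H.s).map H.O) (by simp [array])
    (by
      rw [List.length_append, List.length_append, List.length_append, H.length_prefix]
      simp
      ring)
    hi]

theorem three_add_lt_nodeWidth {v : List (Option (Fin σ))} {i j l : ℕ}
    (hi : (sortedEnds T v)[i]? = some l) (hj : j < 3) : 3 + 3 * i + j < nodeWidth T v := by
  have := (List.getElem?_eq_some_iff.1 hi).1
  rw [sortedEnds, Finset.length_sort] at this
  unfold nodeWidth
  omega

theorem ChildTable.getElem?_slot {v : List (Option (Fin σ))} (hv : IsNode T v) {i j l : ℕ}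
    (hi : (sortedEnds T v)[i]? = some l) (hj : j < 3) :
    H.array[nodeAddr T v + 3 + 3 * i + j]? = (slotWords T v l)[j]? := by
  rw [show nodeAddr T v + 3 + 3 * i + j = nodeAddr T v + (3 + 3 * i + j) by omega,
    H.getElem?_node hv (three_add_lt_nodeWidth hi hj), nodeRecord,
    List.getElem?_append_right (by simp; omega)]
  rw [show 3 + 3 * i + j - [v.length, labelOf T v, parentAddr T v].length = 3 * i + j by
    simp; omega]
  exact getElem?_flatMap_of_length (k := 3) (fun _ => rfl) hi hj

theorem mem_sortedEnds {v : List (Option (Fin σ))} (hv : IsNode T v) {l : ℕ} :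
    l ∈ sortedEnds T v ↔ ∃ p, IsPathEnd T v p l := by
  rw [sortedEnds, Finset.mem_sort, mem_pathEnds hv]

open Classical in
/-- The position of the slot of the path of `p` in the record of `v`. -/
noncomputable def slotIndex (T : List (Fin σ)) (v : List (Option (Fin σ))) (p : List (Fin σ)) : ℕ :=
  if h : ∃ l, IsPathEnd T v p l then (sortedEnds T v).idxOf h.choose else 0

theorem exists_slotIndex {p x : List (Fin σ)} {v : List (Option (Fin σ))}
    (hx : x ∈ periodPath T p) (hv : IsLocus T x v) :
    ∃ l, IsPathEnd T v p l ∧ (sortedEnds T v)[slotIndex T v p]? = some l := by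
  have hex : ∃ l, IsPathEnd T v p l := (exists_isPathEnd hx hv).imp fun _ h => h.1
  refine ⟨hex.choose, hex.choose_spec, ?_⟩
  rw [slotIndex, dif_pos hex]
  exact List.getElem?_idxOf ((mem_sortedEnds hv.1).2 ⟨p, hex.choose_spec⟩)

theorem countP_eq_of_isPathEnd {p x : List (Fin σ)} {v : List (Option (Fin σ))} {l : ℕ}
    (hx : x ∈ periodPath T p) (hv : IsLocus T x v) (hl : IsPathEnd T v p l) :
    ((seqsOf T p).countP fun y => seqLength y < l) =
      (seqsOf T p).countP fun y => seqLength y < x.length := by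
  obtain ⟨y, hy, hyv, rfl⟩ := hl.1
  refine List.countP_congr fun z hz => ?_
  simpa using seqLength_lt_iff_of_isLocus hy hx hyv hv (mem_seqsOf.1 hz)

/-- The array stores the data structure. -/
noncomputable def ChildTable.periodIndex : PeriodIndex T H.array where
  text := 11
  text_eq i a h := by
    have hi := (List.getElem?_eq_some_iff.1 h).1
    rw [H.getElem?_text (by omega), textPart, List.getElem?_append_left (by simpa using hi),
      List.getElem?_map, h]
    rfl
  node := nodeAddr T
  width := nodeWidth T
  width_ge v _ := by unfold nodeWidth; omega
  records_disjoint u v := nodeAddr_disjoint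
  depth_eq v hv := H.getElem?_node hv (j := 0) (by unfold nodeWidth; omega)
  label_eq v hv := ⟨labelOf T v, H.getElem?_node hv (j := 1) (by unfold nodeWidth; omega),
    (labelOf_spec hv).2⟩
  parent_eq u v h := by
    rw [H.getElem?_node h.2.1 (by unfold nodeWidth; omega), ← parentAddr_eq h]
    rfl
  seqs := seqsOf T
  mem_seqs p x := mem_seqsOf
  seqs_nodup := nodup_seqsOf T
  seqs_sorted := sorted_seqsOf T
  list := listAddr T
  list_eq p i x h := by
    have hi := (List.getElem?_eq_some_iff.1 h).1
    constructor
    · rw [H.getElem?_list (by omega)]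
      exact getElem?_flatMap_of_length (k := 2) (j := 0) (fun _ => rfl) h (by norm_num)
    · rw [add_assoc, H.getElem?_list (by omega)]
      exact getElem?_flatMap_of_length (k := 2) (j := 1) (fun _ => rfl) h (by norm_num)
  slot v p := nodeAddr T v + 3 + 3 * slotIndex T v p
  slot_mem v p x hx hv := by
    obtain ⟨l, -, h⟩ := exists_slotIndex hx hv
    have := three_add_lt_nodeWidth h (j := 0) (by norm_num)
    omega
  slot_eq v p x hx hv := by
    obtain ⟨l, hl, h⟩ := exists_slotIndex hx hv
    rw [← countP_eq_of_isPathEnd hx hv hl]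
    rw [← add_zero (nodeAddr T v + 3 + 3 * slotIndex T v p), H.getElem?_slot hv.1 h (by norm_num),
      slotWords, pathPeriod_eq hl]
    rfl

/-- Every cell that the hash function can reach holds a node, also for keys outside the table; hence
the descent is meaningful for patterns that do not occur. -/
theorem ChildTable.exists_next (u : List (Option (Fin σ))) (c : ℕ) :
    ∃ v, IsNode T v ∧ H.array[tableBase T + 3 * H.s +
      hashCell H.q H.a H.s H.A H.B H.O (nodeAddr T u * (σ + 1) + c)]? = some (nodeAddr T v) := by
  obtain ⟨x, hx⟩ : ∃ x, x = nodeAddr T u * (σ + 1) + c := ⟨_, rfl⟩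
  rw [← hx]
  obtain ⟨-, hB, hO⟩ := H.bucket (H.a * x % H.q % H.s) (Nat.mod_lt _ H.s_pos)
  have hlt : hashCell H.q H.a H.s H.A H.B H.O x < H.tab.length :=
    (Nat.add_lt_add_left (Nat.mod_lt _ hB) _).trans_le hO
  obtain ⟨v, hv, he⟩ := H.isNode _ (List.getElem_mem hlt)
  exact ⟨v, hv, by rw [H.getElem?_tab hlt, List.getElem?_eq_getElem hlt, he]⟩

/-- The array provides what the query program needs. -/
noncomputable def ChildTable.queryWords : QueryWords H.periodIndex where
  K := σ + 1
  q := H.q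
  a := H.a
  s := H.s
  addrA := tableBase T
  addrB := tableBase T + H.s
  addrO := tableBase T + 2 * H.s
  addrTab := tableBase T + 3 * H.s
  A := H.A
  B := H.B
  O := H.O
  header := by
    have h : H.header <+: H.array := by simp [array]
    exact (List.prefix_iff_eq_take.1 h).symm
  text_end := by
    change H.array[11 + T.length]? = _
    rw [H.getElem?_text (by omega)]
    simp [textPart]
  q_pos := H.q_pos
  s_pos := H.s_pos
  A_eq b := H.getElem?_A
  B_eq b := H.getElem?_B
  B_pos b hb := (H.bucket b hb).2.1
  O_eq b := H.getElem?_O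
  next u c := (H.exists_next u c).choose
  next_isNode u c _ := (H.exists_next u c).choose_spec.1
  next_eq u c v hu hv := by
    obtain ⟨h1, h2⟩ := (H.exists_next u (c + 1)).choose_spec
    have h3 := H.child u c v hu hv
    have h4 := H.getElem?_tab (List.getElem?_eq_some_iff.1 h3).1
    exact (nodeAddr_injective hv.1 h1 (Option.some.inj (h3.symm.trans (h4.symm.trans h2)))).symm
  tab_eq u c _ := (H.exists_next u c).choose_spec.2
  ends := sortedEnds T
  ends_sorted v := (Finset.sortedLT_sort _).pairwise
  mem_ends v l hv := mem_sortedEnds hv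
  ends_eq v j l hv h := H.getElem?_slot hv h (j := 1) (by norm_num)
  ptr_eq v j p l hl hv h := by
    change H.array[nodeAddr T v + 3 + 3 * j + 0]? = _
    rw [H.getElem?_slot hv h (by norm_num), slotWords, pathPeriod_eq hl]
    rfl
  last_eq v j p l hl hv h := by
    change H.array[nodeAddr T v + 3 + 3 * j + 2]? = _
    rw [H.getElem?_slot hv h (by norm_num), slotWords, pathPeriod_eq hl]
    rfl

/-! ### Bounds for the space and for the words -/

theorem log_succ_le {n : ℕ} (hn : 2 ≤ n) : Nat.log 2 (n + 1) ≤ Nat.log 2 n + 1 := by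
  rw [← Nat.log_mul_base (by norm_num) (by omega)]
  exact Nat.log_mono_right (by omega)

theorem ChildTable.length_array_le (hT : 2 ≤ T.length) :
    H.array.length ≤ 200 * (T.length * Nat.log 2 T.length) := by
  have hlog := log_succ_le hT
  have hlog1 : 1 ≤ Nat.log 2 T.length := Nat.log_pos (by norm_num) hT
  have hN := card_nodeSet_le T
  have hnodes : ∑ v ∈ nodeSet T, nodeWidth T v ≤
      (4 * T.length) * (3 + 3 * (6 * Nat.log 2 T.length)) := by
    refine (Finset.sum_le_card_nsmul _ _ (3 + 3 * (6 * Nat.log 2 T.length)) fun v _ => ?_).trans ?_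
    · have := card_pathEnds_le T v
      unfold nodeWidth
      omega
    · exact Nat.mul_le_mul_right _ (by omega)
  have hlists := (sum_length_seqsOf_le T).trans (Nat.mul_le_mul_left 2 (card_runs_le T))
  have h1 := H.length_array
  have h2 := H.s_le
  have h3 := H.length_le
  unfold tableBase listBase at h1
  have hX : T.length ≤ T.length * Nat.log 2 T.length := Nat.le_mul_of_pos_right _ hlog1
  have e1 : (4 * T.length) * (3 + 3 * (6 * Nat.log 2 T.length)) =
      12 * T.length + 72 * (T.length * Nat.log 2 T.length) := by ring
  have e2 : 2 * (2 * (Nat.log 2 T.length + 1) * T.length) =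
      4 * T.length + 4 * (T.length * Nat.log 2 T.length) := by ring
  omega

/-- A bound for all words of the array. -/
theorem ChildTable.le_of_mem_array (w : ℕ) (hw : w ∈ H.array) :
    w ≤ 2 * ((H.array.length + 1) * (σ + 1)) + 4 := by
  obtain ⟨Λ, hΛ⟩ : ∃ Λ, Λ = H.array.length := ⟨_, rfl⟩
  rw [← hΛ]
  have hlen := H.length_array
  have hlb : 11 + (T.length + 1) ≤ listBase T := by unfold listBase; omega
  have htb : listBase T ≤ tableBase T := by unfold tableBase; omega
  have hnode : ∀ v, IsNode T v → nodeAddr T v ≤ Λ := by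
    intro v hv
    have := nodeAddr_add_le hv
    omega
  have hq : H.q ≤ 2 * ((Λ + 1) * (σ + 1)) := by
    refine H.q_le.trans (Nat.mul_le_mul_left 2 (Nat.mul_le_mul_right _ ?_))
    omega
  have hbig : ∀ y, y ≤ Λ + 1 ∨ y ≤ σ + 1 ∨ y ≤ H.q → y ≤ 2 * ((Λ + 1) * (σ + 1)) + 4 := by
    have h1 := Nat.le_mul_of_pos_right (Λ + 1) (Nat.succ_pos σ)
    have h2 := Nat.le_mul_of_pos_left (σ + 1) (Nat.succ_pos Λ)
    simp only [Nat.succ_eq_add_one] at h1 h2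
    intro y hy
    omega
  simp only [array, List.mem_append, List.mem_map, List.mem_range] at hw
  refine hbig w ?_
  rcases hw with ((((((hw | hw) | hw) | hw) | ⟨b, hb, rfl⟩) | ⟨b, hb, rfl⟩) | ⟨b, hb, rfl⟩) | hw
  · have hroot := hnode [] (isNode_nil T)
    have ha := H.a_lt
    simp only [header, List.mem_cons, List.not_mem_nil, or_false] at hw
    omega
  · simp only [textPart, List.mem_append, List.mem_map, List.mem_singleton] at hw
    rcases hw with ⟨c, -, rfl⟩ | rfl
    · have := c.isLt
      omega
    · omega
  · obtain ⟨v, hv, hw⟩ := List.mem_flatMap.1 hw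
    have hv := mem_nodeSet.1 (Finset.mem_toList.1 hv)
    have h1 := hv.length_le
    have h2 := (labelOf_spec hv).1
    have h3 : parentAddr T v ≤ Λ := by
      rw [parentAddr]
      split_ifs with h
      · exact hnode _ h.choose_spec.1
      · omega
    simp only [nodeRecord, List.mem_append, List.mem_cons, List.not_mem_nil, or_false,
      List.mem_flatMap, slotWords] at hw
    rcases hw with hw | ⟨l, hl, hw⟩
    · omega
    · obtain ⟨p, hp⟩ := (mem_sortedEnds hv).1 hl
      have h4 := hp.le_length
      have h5 := listAddr_add_le (T := T) (pathPeriod T v l)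
      have h6 := List.countP_le_length (l := seqsOf T (pathPeriod T v l))
        (p := fun y => decide (seqLength y < l))
      omega
  · obtain ⟨p, -, hw⟩ := List.mem_flatMap.1 hw
    obtain ⟨x, hx, hw⟩ := List.mem_flatMap.1 hw
    have h := mem_seqsOf.1 hx
    have h1 := h.1
    have h2 := h.2.1
    simp only [List.mem_cons, List.not_mem_nil, or_false] at hw
    omega
  · have := (H.bucket b hb).1
    omega
  · have := (H.bucket b hb).2.2
    omega
  · have := (H.bucket b hb).2.2
    omega
  · obtain ⟨v, hv, rfl⟩ := H.isNode w hw
    have := hnode v hv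
    omega

theorem ChildTable.fits (hT : 2 ≤ T.length) :
    Fits σ H.array (2 * ((H.array.length + 1) * (σ + 1)) + 4) ((T.length + σ) ^ 30) where
  word_le := H.le_of_mem_array
  length_le := by
    have := Nat.le_mul_of_pos_right (H.array.length + 1) (Nat.succ_pos σ)
    simp only [Nat.succ_eq_add_one] at this
    omega
  sigma_le := by
    have := Nat.le_mul_of_pos_left (σ + 1) (Nat.succ_pos H.array.length)
    simp only [Nat.succ_eq_add_one] at this
    omega
  four_le := by omega
  cube_le := by
    have hσ : 0 < σ := by
      rcases Nat.eq_zero_or_pos σ with rfl | h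
      · match T, hT with
        | c :: _, _ => exact c.elim0
      · exact h
    -- the bound is at most `3 ^ 7 * z ^ 3` for `z = n + σ`, and `3 ≤ z`
    obtain ⟨z, hz⟩ : ∃ z, z = T.length + σ := ⟨_, rfl⟩
    rw [← hz, show 30 = 10 * 3 by norm_num, pow_mul]
    refine Nat.pow_le_pow_left ?_ 3
    have h1 : H.array.length ≤ 200 * z ^ 2 := by
      refine (H.length_array_le hT).trans (Nat.mul_le_mul_left _ ?_)
      rw [sq]
      exact Nat.mul_le_mul (by omega) ((Nat.log_le_self 2 _).trans (by omega))
    have hz3 : 3 ≤ z := by omega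
    have h2 : H.array.length + 1 ≤ 201 * z ^ 2 := by nlinarith
    have h3 : (H.array.length + 1) * (σ + 1) ≤ 201 * z ^ 2 * z := Nat.mul_le_mul h2 (by omega)
    have h4 : 3 ^ 7 ≤ z ^ 7 := Nat.pow_le_pow_left hz3 7
    have h5 : z ^ 10 = z ^ 7 * (z ^ 2 * z) := by ring
    have h6 : 27 ≤ z ^ 2 * z := by nlinarith
    rw [h5]
    nlinarith [Nat.mul_le_mul_right (z ^ 2 * z) h4]

theorem drop_countP_eq_filter {ι : Type*} (f : ι → ℕ) (m : ℕ) {l : List ι}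
    (h : l.Pairwise fun x y => f x ≤ f y) :
    l.drop (l.countP fun y => f y < m) = l.filter fun y => m ≤ f y := by
  induction l with
  | nil => rfl
  | cons a l ih =>
    rw [List.pairwise_cons] at h
    by_cases ha : f a < m
    · rw [List.countP_cons_of_pos (by simpa using ha), List.drop_succ_cons, ih h.2,
        List.filter_cons_of_neg (by simpa using ha)]
    · have hall : ∀ y ∈ a :: l, m ≤ f y := by
        intro y hy
        rcases List.mem_cons.1 hy with rfl | hy
        · omega
        · exact (not_lt.1 ha).trans (h.1 y hy)
      rw [List.countP_eq_zero.2 (by simpa using hall), List.drop_zero,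
        List.filter_eq_self.2 (by simpa using hall)]

end Array

end PeriodIndexing

theorem mainTheorem4 :
    ∃ (C k : ℕ) (query : PeriodIndexing.Cmd),
      ∀ (σ : ℕ) (T : List (Fin σ)), 2 ≤ T.length →
        ∃ (M : List ℕ) (D : PeriodIndexing.PeriodIndex T M),
          (∀ w ∈ M, w < (T.length + σ) ^ k) ∧
          M.length ≤ C * (T.length * Nat.log 2 T.length) ∧
          ∀ P : List (Fin σ), PeriodIndexing.IsPeriodicPattern P →
            ∃ (L : List (ℕ × ℕ)) (t : ℕ),
              PeriodIndexing.Outputs ((T.length + σ) ^ k) M P query t L ∧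
              t ≤ C * (P.length + PeriodIndexing.occNO T P) ∧
              L.Nodup ∧
              (∀ x, x ∈ L ↔ x ∈ PeriodIndexing.periodSequencesOf T P) ∧
              (∀ p, PeriodIndexing.IsShortestPeriod p P → L <:+ D.seqs p) := by
  -- `200` steps per letter and per output sequence, and three sequences per occurrence
  refine ⟨600, 30, PeriodIndexing.query, fun σ T hT => ?_⟩
  obtain ⟨H⟩ := PeriodIndexing.exists_childTable T
  have F := H.fits hT
  refine ⟨H.array, H.periodIndex, fun w hw => F.four_mul_lt ((F.word_le w hw).trans (by omega)),
    (H.length_array_le hT).trans (Nat.mul_le_mul_right _ (by norm_num)), fun P hP => ?_⟩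
  obtain ⟨p, hp, hlen⟩ := hP.exists_isShortestPeriod
  obtain ⟨L, hL⟩ : ∃ L, L = (H.periodIndex.seqs p).drop
    ((H.periodIndex.seqs p).countP fun y => PeriodIndexing.seqLength y < P.length) := ⟨_, rfl⟩
  have hnodup : L.Nodup := hL ▸ (H.periodIndex.seqs_nodup p).sublist (List.drop_sublist _ _)
  have hmem : ∀ x, x ∈ L ↔ x ∈ PeriodIndexing.periodSequencesOf T P := by
    intro x
    rw [hL, PeriodIndexing.drop_countP_eq_filter _ _ (H.periodIndex.seqs_sorted p),
      List.mem_filter, H.periodIndex.mem_seqs, PeriodIndexing.mem_periodSequencesOf_iff hp]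
    simp
  have hocc : L ≠ [] → P <:+: T := by
    intro h
    obtain ⟨x, hx⟩ := List.exists_mem_of_ne_nil L h
    obtain ⟨_, -, -, hpre⟩ := (hmem x).1 hx
    exact PeriodIndexing.prefix_drop_infix (hpre.trans (PeriodIndexing.substr_prefix_drop _ _ _))
  obtain ⟨t, hout, ht⟩ :=
    PeriodIndexing.exists_outputs_query H.queryWords F hP hp hL hocc
  have hcard := PeriodIndexing.length_le_three_mul_occNO hp hlen hnodup fun x hx => (hmem x).1 hx
  refine ⟨L, t, hout, by omega, hnodup, hmem, fun q hq => ?_⟩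
  rw [hq.eq hp, hL]
  exact List.drop_suffix _ _
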